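/- **Proposition 4.3.** Let $0<s<1$, let $P,Q$ be irreducible $2\times2$ stochastic matrices (non-negative entries, row sums $1$), and let $E$ be a $2\times 2$ matrix such that $$R=\begin{pmatrix} sQ & E\\ 0 & P\end{pmatrix}$$ is a stochastic matrix. Consider the four-color urn with replacement matrix $R$: the row vector $C_n\in[0,\infty)^4$ is the urn content after $n$ trials, $C_0$ is a non-random probability vector, and at trial $n+1$, conditionally on $\mathcal F_n=\sigma(C_0,\dots,C_n)$, color $i$ is drawn with probability $C_{n,i}/(n+1)$; if color $i$ is drawn, then $C_{n+1}=C_n+(\text{row } i \text{ of } R)$. Assume that all the eigenvalues of $R$ are distinct. Let $\beta$ be the eigenvalue of $P$ other than $1$, let $v_3\neq 0$ be a column vector with $Rv_3=\beta v_3$, let $\nu\in\mathbb R^2$ be the vector of the last two coordinates of $v_3$, let $\nu^2$ be the vector of the squares of the coordinates of $\nu$, let $\pi_P$ be the stationary distribution of $P$ (a row probability vector with $\pi_PP=\pi_P$), and let $\Pi_n(\beta)=\prod_{j=0}^{n-1}\bigl(1+\frac{\beta}{j+1}\bigr)$. Then: (i) If $\beta<1/2$, then $C_nv_3/\sqrt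 n\Rightarrow N\bigl(0,\frac{\beta^2}{1-2\beta}\,\pi_P\nu^2\bigr)$. (ii) If $\beta=1/2$, then $C_nv_3/\sqrt{n\log n}\Rightarrow N\bigl(0,\beta^2\,\pi_P\nu^2\bigr)$. (iii) If $\beta>1/2$, then $C_nv_3/\Pi_n(\beta)$ is an $L^2$-bounded martingale with respect to $(\mathcal F_n)$, and $C_nv_3/n^\beta$ converges almost surely to a non-degenerate random variable, that is, one that is not almost surely constant. Here $\Rightarrow$ denotes convergence in distribution, and $N(0,0)$ is the point mass at $0$. -/

import Mathlib

open MeasureTheory ProbabilityTheory Filter Topology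
open scoped NNReal ENNReal Matrix

/-- The vector of ball contents after `n` trials. The urn starts with contents `c₀`; if the colour
drawn in trial `n + 1` is `i = X n ω`, then row `i` of the replacement matrix `R` is added. -/
def urnContents {Ω ι : Type*} (R : Matrix ι ι ℝ) (c₀ : ι → ℝ) (X : ℕ → Ω → ι) :
    ℕ → Ω → ι → ℝ
  | 0, _ => c₀
  | n + 1, ω => urnContents R c₀ X n ω + R (X n ω)

theorem measurable_urnContents {Ω ι : Type*} [Fintype ι] [MeasurableSpace Ω]
    (R : Matrix ι ι ℝ) (c₀ : ι → ℝ) (X : ℕ → Ω → ι)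
    (hX : ∀ n i, MeasurableSet (X n ⁻¹' {i})) (n : ℕ) :
    Measurable (urnContents R c₀ X n) := by
  induction n with
  | zero => exact measurable_const
  | succ n ih =>
    let _ : MeasurableSpace ι := ⊤
    have h1 : Measurable (X n) := measurable_to_countable' (hX n)
    have h2 : Measurable (fun i : ι => (R i : ι → ℝ)) := measurable_from_top
    exact ih.add (h2.comp h1)

/-- The natural filtration of the sequence of urn contents. -/
def urnFiltration {Ω ι : Type*} [Fintype ι] [mΩ : MeasurableSpace Ω]
    (R : Matrix ι ι ℝ) (c₀ : ι → ℝ) (X : ℕ → Ω → ι)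
    (hX : ∀ n i, MeasurableSet (X n ⁻¹' {i})) : Filtration ℕ mΩ :=
  Filtration.natural (urnContents R c₀ X)
    (fun n => (measurable_urnContents R c₀ X hX n).stronglyMeasurable)

/-- `X` is a sequence of random draws from the urn with replacement matrix `R` (all row sums one)
and initial contents `c₀` (total mass one): given the past `C_0, …, C_n` of the urn contents, the
colour `X n` drawn in trial `n + 1` equals `i` with probability `C_n(i) / (n + 1)`, the proportion
of colour `i` in the urn. -/
structure IsUrnDraws {Ω ι : Type*} [Fintype ι] [MeasurableSpace Ω] (μ : Measure Ω)
    (R : Matrix ι ι ℝ) (c₀ : ι → ℝ) (X : ℕ → Ω → ι) : Prop where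
  measurableSet_draw : ∀ n i, MeasurableSet (X n ⁻¹' {i})
  condProb_draw : ∀ n i,
    μ[(X n ⁻¹' {i}).indicator (fun _ => (1 : ℝ)) | urnFiltration R c₀ X measurableSet_draw n]
      =ᵐ[μ] fun ω => urnContents R c₀ X n ω i / ((n : ℝ) + 1)

/-- The normalising product `Π_n(t) = ∏_{j=0}^{n-1} (1 + t / (j + 1))`. -/
noncomputable def urnProd (n : ℕ) (t : ℝ) : ℝ :=
  ∏ j ∈ Finset.range n, (1 + t / ((j : ℝ) + 1))

/-- The block upper triangular replacement matrix `[[sQ, E], [0, P]]` of the four-colour urn. The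
colours white and black are `Sum.inl 0`, `Sum.inl 1`, green and yellow `Sum.inr 0`, `Sum.inr 1`. -/
def fourColorMatrix (s : ℝ) (Q E P : Matrix (Fin 2) (Fin 2) ℝ) :
    Matrix (Fin 2 ⊕ Fin 2) (Fin 2 ⊕ Fin 2) ℝ :=
  Matrix.fromBlocks (s • Q) E 0 P

/-! Write Y_n = C_n v_3. Because v_3 is a right eigenvector, drawing colour i adds β v_3(i) to Y_n.
Given the past, this increment has mean βY_n/(n+1), and its second moment is β² times the average of
v_3² over the colour proportions. The theorem rests on the convergence of that average.

Law of large numbers. The indicator of white and black is an eigenvector with eigenvalue s < 1, so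
the expected share of those colours vanishes; a second-moment recursion gives E[Y_n²]/(n+1)² → 0. On
green and yellow, ν takes two values and π_P ν = 0, hence ν_j² = π_P ν² + (ν_0 + ν_1) ν_j. So the
average of v_3² tends to π_P ν² in L¹, without any limit theorem for the proportions themselves
(`IsUrnDraws.tendsto_integral_abs_sum_urnProp_sub`).

Case β ≤ 1/2. In the characteristic function of Y_n/r_n the increments are replaced one at a time by
Gaussian factors (`IsUrnDraws.norm_integral_cexp_sub_le`). The frequency at time k is t ∏_{k≤j<n}(1
+ β/(j+1))/r_n, which absorbs the conditional means. The variance is then a sum of squared products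
that solves S_{n+1} = (1 + β/(n+1))² S_n + g_n with g_n convergent, and S_n grows like n or, at β =
1/2, like n log n.

Case β > 1/2. Y_n/Π_n(β) is a martingale, bounded in L² since Σ Π_n(β)⁻² < ∞. If its limit were
constant, uniform integrability would make the martingale itself constant, so each draw would
satisfy v_3(X_n) = d Π_n(β)/(n+1) → 0, against E[v_3(X_n)²] → π_P ν² > 0
(`IsUrnDraws.exists_ae_tendsto`). -/

/-! ### Scalar recursions -/

theorem tendsto_sum_range_inv_succ_atTop :
    Tendsto (fun n : ℕ => ∑ k ∈ Finset.range n, ((k : ℝ) + 1)⁻¹) atTop atTop := by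
  simpa [one_div] using Real.tendsto_sum_range_one_div_nat_succ_atTop

/-- From 1 - x ≤ exp(-x), the sequence is at most a constant times exp(-c H_n), and the harmonic
sums H_n diverge. -/
theorem tendsto_zero_of_le_one_sub_div_mul {y : ℕ → ℝ} {c : ℝ} (hc : 0 < c) (hy : ∀ n, 0 ≤ y n)
    (h : ∀ᶠ n : ℕ in atTop, y (n + 1) ≤ (1 - c / ((n : ℝ) + 1)) * y n) :
    Tendsto y atTop (𝓝 0) := by
  obtain ⟨N, hN⟩ := eventually_atTop.1 h
  set H : ℕ → ℝ := fun n => ∑ k ∈ Finset.range n, ((k : ℝ) + 1)⁻¹ with hH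
  have key : ∀ n, N ≤ n → y n ≤ y N * Real.exp (c * H N) * Real.exp (-(c * H n)) := by
    intro n hn
    induction n, hn using Nat.le_induction with
    | base => rw [mul_assoc, ← Real.exp_add]; simp
    | succ n hn ih =>
      have h1 : 1 - c / ((n : ℝ) + 1) ≤ Real.exp (-(c * ((n : ℝ) + 1)⁻¹)) := by
        have := Real.add_one_le_exp (-(c * ((n : ℝ) + 1)⁻¹))
        rw [div_eq_mul_inv]; linarith
      have h2 : H (n + 1) = H n + ((n : ℝ) + 1)⁻¹ := by simp [hH, Finset.sum_range_succ]
      calc y (n + 1) ≤ (1 - c / ((n : ℝ) + 1)) * y n := hN n hn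
        _ ≤ Real.exp (-(c * ((n : ℝ) + 1)⁻¹)) * y n := by gcongr; exact hy n
        _ ≤ Real.exp (-(c * ((n : ℝ) + 1)⁻¹)) *
            (y N * Real.exp (c * H N) * Real.exp (-(c * H n))) := by gcongr
        _ = _ := by
          rw [h2, show -(c * (H n + ((n : ℝ) + 1)⁻¹)) = -(c * ((n : ℝ) + 1)⁻¹) + -(c * H n) by ring,
            Real.exp_add]
          ring
  have hlim : Tendsto (fun n => y N * Real.exp (c * H N) * Real.exp (-(c * H n))) atTop (𝓝 0) := by
    have : Tendsto (fun n => Real.exp (-(c * H n))) atTop (𝓝 0) :=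
      Real.tendsto_exp_neg_atTop_nhds_zero.comp
        (tendsto_sum_range_inv_succ_atTop.const_mul_atTop hc)
    simpa using this.const_mul (y N * Real.exp (c * H N))
  exact tendsto_of_tendsto_of_tendsto_of_le_of_le' tendsto_const_nhds hlim
    (Eventually.of_forall hy) (eventually_atTop.2 ⟨N, key⟩)

/-- Once η n < cε/2, the positive part of y - ε/2 satisfies the inequality without forcing term. -/
theorem tendsto_zero_of_le_one_sub_div_mul_add {y η : ℕ → ℝ} {c : ℝ} (hc : 0 < c)
    (hy : ∀ n, 0 ≤ y n) (hη : Tendsto η atTop (𝓝 0))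
    (h : ∀ᶠ n : ℕ in atTop, y (n + 1) ≤ (1 - c / ((n : ℝ) + 1)) * y n + η n / ((n : ℝ) + 1)) :
    Tendsto y atTop (𝓝 0) := by
  refine tendsto_order.2 ⟨fun a ha => Eventually.of_forall fun n => ha.trans_le (hy n),
    fun ε hε => ?_⟩
  have hz : Tendsto (fun n => max (y n - ε / 2) 0) atTop (𝓝 0) := by
    refine tendsto_zero_of_le_one_sub_div_mul hc (fun n => le_max_right _ _) ?_
    have h1 : ∀ᶠ n in atTop, η n < c * (ε / 2) := (tendsto_order.1 hη).2 _ (by positivity)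
    have h2 : ∀ᶠ n : ℕ in atTop, c ≤ n := tendsto_natCast_atTop_atTop.eventually_ge_atTop c
    filter_upwards [h, h1, h2] with n hn h1 h2
    have hm : (0 : ℝ) < n + 1 := by positivity
    have hc1 : c / ((n : ℝ) + 1) ≤ 1 := by rw [div_le_one hm]; linarith
    refine max_le ?_ (mul_nonneg (by linarith) (le_max_right _ _))
    have h3 : η n / ((n : ℝ) + 1) ≤ c / ((n : ℝ) + 1) * (ε / 2) := by
      rw [div_mul_eq_mul_div]; gcongr
    have h4 : (1 - c / ((n : ℝ) + 1)) * (y n - ε / 2) ≤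
        (1 - c / ((n : ℝ) + 1)) * max (y n - ε / 2) 0 :=
      mul_le_mul_of_nonneg_left (le_max_left _ _) (by linarith)
    linarith
  filter_upwards [(tendsto_order.1 hz).2 (ε / 2) (by positivity)] with n hn
  have := (le_max_left _ _).trans_lt hn
  linarith

theorem tendsto_inv_succ : Tendsto (fun n : ℕ => ((n : ℝ) + 1)⁻¹) atTop (𝓝 0) := by
  simpa [one_div] using tendsto_one_div_add_atTop_nhds_zero_nat (𝕜 := ℝ)

/-- Asymptotics of the solutions of a linear recursion, subcritical case. -/
theorem tendsto_div_of_recursion {β g₀ : ℝ} (hβ : β < 1 / 2) {S g : ℕ → ℝ}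
    (hS : ∀ n : ℕ, S (n + 1) = (1 + β / ((n : ℝ) + 1)) ^ 2 * S n + g n)
    (hg : Tendsto g atTop (𝓝 g₀)) :
    Tendsto (fun n : ℕ => S n / n) atTop (𝓝 (g₀ / (1 - 2 * β))) := by
  set L := g₀ / (1 - 2 * β) with hL
  have hβ' : (0 : ℝ) < 1 - 2 * β := by linarith
  have hL' : L * (1 - 2 * β) = g₀ := div_mul_cancel₀ _ hβ'.ne'
  rw [tendsto_iff_norm_sub_tendsto_zero]
  simp only [Real.norm_eq_abs]
  -- With m = n + 1, (1 + β/m)²(m - 1)/m = 1 - (1 - 2β)/m + r/m². Half of the rate 1 - 2β is given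
  -- up below to absorb r/m².
  set r : ℕ → ℝ := fun n => (β ^ 2 - 2 * β) - β ^ 2 * ((n : ℝ) + 1)⁻¹ with hr
  have hrlim : Tendsto (fun n => r n * ((n : ℝ) + 1)⁻¹) atTop (𝓝 0) := by
    simpa using ((tendsto_const_nhds (x := β ^ 2 - 2 * β)).sub
      (tendsto_inv_succ.const_mul (β ^ 2))).mul tendsto_inv_succ
  have hη : Tendsto (fun n => |g n - g₀| + |L| * |r n * ((n : ℝ) + 1)⁻¹|) atTop (𝓝 0) := by
    have h1 : Tendsto (fun n => |g n - g₀|) atTop (𝓝 0) := by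
      simpa using (hg.sub_const g₀).abs
    simpa using h1.add (hrlim.abs.const_mul |L|)
  refine tendsto_zero_of_le_one_sub_div_mul_add (c := (1 - 2 * β) / 2) (by linarith)
    (fun n => abs_nonneg _) hη ?_
  have h1 : ∀ᶠ n in atTop, r n * ((n : ℝ) + 1)⁻¹ < (1 - 2 * β) / 2 :=
    (tendsto_order.1 hrlim).2 _ (by linarith)
  filter_upwards [h1, eventually_ge_atTop 1] with n hn hn1
  have hn0 : (0 : ℝ) < n := by exact_mod_cast hn1
  have hm : (0 : ℝ) < (n : ℝ) + 1 := by positivity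
  set ρ : ℝ := (1 + β / ((n : ℝ) + 1)) ^ 2 * (n / ((n : ℝ) + 1)) with hρ
  have hρ0 : 0 ≤ ρ := by positivity
  have hρ1 : ρ = 1 - (1 - 2 * β) / ((n : ℝ) + 1) + r n * ((n : ℝ) + 1)⁻¹ / ((n : ℝ) + 1) := by
    rw [hρ, hr]; field_simp; ring
  have hρ2 : ρ ≤ 1 - (1 - 2 * β) / 2 / ((n : ℝ) + 1) := by
    rw [hρ1]
    have : r n * ((n : ℝ) + 1)⁻¹ / ((n : ℝ) + 1) ≤ (1 - 2 * β) / 2 / ((n : ℝ) + 1) := by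
      gcongr
    have h3 : (1 - 2 * β) / ((n : ℝ) + 1) = (1 - 2 * β) / 2 / ((n : ℝ) + 1) +
      (1 - 2 * β) / 2 / ((n : ℝ) + 1) := by ring
    linarith
  have hrec : S (n + 1) / ((n + 1 : ℕ) : ℝ) - L = ρ * (S n / n - L) +
      ((g n - g₀) + L * (r n * ((n : ℝ) + 1)⁻¹)) / ((n : ℝ) + 1) := by
    have e1 : S (n + 1) / ((n + 1 : ℕ) : ℝ) = ρ * (S n / n) + g n / ((n : ℝ) + 1) := by
      rw [hS, hρ]; push_cast; field_simp
    have e2 : ρ * L = L - g₀ / ((n : ℝ) + 1) + L * (r n * ((n : ℝ) + 1)⁻¹) / ((n : ℝ) + 1) := by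
      rw [hρ1, ← hL']; ring
    rw [e1, mul_sub, e2]
    ring
  rw [hrec]
  refine (abs_add_le _ _).trans ?_
  rw [abs_mul, abs_of_nonneg hρ0, abs_div, abs_of_pos hm]
  gcongr
  exact (abs_add_le _ _).trans (by rw [abs_mul])

theorem tendsto_log_div_succ : Tendsto (fun n : ℕ => Real.log n / ((n : ℝ) + 1)) atTop (𝓝 0) := by
  have h := Real.isLittleO_log_id_atTop.tendsto_div_nhds_zero.comp tendsto_natCast_atTop_atTop
  refine squeeze_zero' (Eventually.of_forall fun n => ?_) ?_ h
  · positivity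
  · filter_upwards [eventually_ge_atTop 1] with n hn
    have hn0 : (0 : ℝ) < n := by exact_mod_cast hn
    simp only [Function.comp_apply, id_eq]
    gcongr
    linarith

theorem tendsto_sum_range_inv_succ_div_log :
    Tendsto (fun n : ℕ => (∑ k ∈ Finset.range n, ((k : ℝ) + 1)⁻¹) / Real.log n) atTop (𝓝 1) := by
  have hlog : Tendsto (fun n : ℕ => Real.log n) atTop atTop :=
    Real.tendsto_log_atTop.comp tendsto_natCast_atTop_atTop
  have h := (Real.tendsto_harmonic_sub_log.div_atTop hlog).add_const 1
  rw [zero_add] at h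
  refine h.congr' ?_
  filter_upwards [eventually_ge_atTop 2] with n hn
  have : (0 : ℝ) < Real.log n := Real.log_pos (by exact_mod_cast hn)
  simp only [harmonic]
  push_cast
  field_simp
  ring

/-- Logarithmic averages of a convergent sequence. -/
theorem tendsto_sum_range_div_succ_div_log {g : ℕ → ℝ} {g₀ : ℝ} (hg : Tendsto g atTop (𝓝 g₀)) :
    Tendsto (fun n : ℕ => (∑ k ∈ Finset.range n, g k / ((k : ℝ) + 1)) / Real.log n) atTop
      (𝓝 g₀) := by
  have hlittle : (fun k : ℕ => (g k - g₀) / ((k : ℝ) + 1)) =o[atTop]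
      fun k : ℕ => ((k : ℝ) + 1)⁻¹ := by
    rw [Asymptotics.isLittleO_iff_tendsto']
    · have := hg.sub_const g₀
      rw [sub_self] at this
      refine this.congr fun n => ?_
      have : (0 : ℝ) < (n : ℝ) + 1 := by positivity
      field_simp
    · refine Eventually.of_forall fun n h => ?_
      have : (0 : ℝ) < ((n : ℝ) + 1)⁻¹ := by positivity
      exact absurd h this.ne'
  have h1 := (hlittle.sum_range (fun n => by positivity)
    tendsto_sum_range_inv_succ_atTop).tendsto_div_nhds_zero
  have h2 := (h1.mul tendsto_sum_range_inv_succ_div_log).add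
    (tendsto_sum_range_inv_succ_div_log.const_mul g₀)
  simp only [mul_one, zero_add] at h2
  refine h2.congr' ?_
  filter_upwards [eventually_ge_atTop 1] with n hn
  have hpos : (0 : ℝ) < ∑ k ∈ Finset.range n, ((k : ℝ) + 1)⁻¹ :=
    Finset.sum_pos (fun k _ => by positivity) ⟨0, by simp; omega⟩
  rw [div_mul_div_cancel₀ hpos.ne', ← mul_div_assoc, ← add_div, Finset.mul_sum,
    ← Finset.sum_add_distrib]
  congr 1
  exact Finset.sum_congr rfl fun k _ => by ring

/-- Asymptotics of the solutions of a linear recursion, critical case. -/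
theorem tendsto_div_mul_log_of_recursion {g₀ : ℝ} {S g : ℕ → ℝ} (hS0 : S 0 = 0)
    (hS : ∀ n : ℕ, S (n + 1) = (1 + 1 / 2 / ((n : ℝ) + 1)) ^ 2 * S n + g n)
    (hg : Tendsto g atTop (𝓝 g₀)) :
    Tendsto (fun n : ℕ => S n / (n * Real.log n)) atTop (𝓝 g₀) := by
  obtain ⟨K, hK⟩ := (Metric.isBounded_range_of_tendsto g hg).exists_norm_le
  have hgK : ∀ n, |g n| ≤ K := fun n => hK _ ⟨n, rfl⟩
  have hK0 : 0 ≤ K := (abs_nonneg _).trans (hgK 0)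
  set H : ℕ → ℝ := fun n => ∑ k ∈ Finset.range n, ((k : ℝ) + 1)⁻¹ with hH
  -- At β = 1/2 the term of order 1/(n+1) in the expansion cancels, leaving only e/(n+1)². Hence S n
  -- / n is essentially the sum of g k/(k+1).
  set e : ℕ → ℝ := fun n => 3 / 4 + ((n : ℝ) + 1)⁻¹ / 4 with he
  set z : ℕ → ℝ := fun n => S n / n with hz
  have hz0 : z 0 = 0 := by simp [hz]
  have hrec : ∀ n : ℕ, z (n + 1) = (1 - e n / ((n : ℝ) + 1) ^ 2) * z n + g n / ((n : ℝ) + 1) := by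
    intro n
    -- At n = 0 division by zero gives z 0 = 0, and S 0 = 0 makes the recursion hold there too.
    rcases Nat.eq_zero_or_pos n with rfl | hn
    · simp [hz, hS, hS0]
    · have hn0 : (0 : ℝ) < n := by exact_mod_cast hn
      simp only [hz, hS, he]
      push_cast
      field_simp
      ring
  have he0 : ∀ n, 0 ≤ e n := fun n => by positivity
  have he1 : ∀ n, e n ≤ 1 := fun n => by
    have : ((n : ℝ) + 1)⁻¹ ≤ 1 := inv_le_one_of_one_le₀ (by simp)
    simp only [he]; linarith
  have hzH : ∀ n, |z n| ≤ K * H n := by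
    intro n
    induction n with
    | zero => simp [hz0, hH]
    | succ n ih =>
      have hq0 : 0 ≤ 1 - e n / ((n : ℝ) + 1) ^ 2 := by
        have : e n / ((n : ℝ) + 1) ^ 2 ≤ 1 := by
          rw [div_le_one (by positivity)]
          have h0 : (0 : ℝ) ≤ n := by positivity
          nlinarith [he1 n]
        linarith
      have hq1 : 1 - e n / ((n : ℝ) + 1) ^ 2 ≤ 1 := by
        have : 0 ≤ e n / ((n : ℝ) + 1) ^ 2 := div_nonneg (he0 n) (by positivity)
        linarith
      have hH1 : H (n + 1) = H n + ((n : ℝ) + 1)⁻¹ := by simp [hH, Finset.sum_range_succ]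
      rw [hrec, hH1]
      refine (abs_add_le _ _).trans ?_
      rw [abs_mul, abs_of_nonneg hq0, abs_div (g n),
        abs_of_pos (by positivity : (0 : ℝ) < (n : ℝ) + 1),
        mul_add]
      refine add_le_add ((mul_le_of_le_one_left (abs_nonneg _) hq1).trans ih) ?_
      · rw [div_eq_mul_inv]
        gcongr
        exact hgK n
  have hHn : Tendsto (fun n : ℕ => H n / ((n : ℝ) + 1)) atTop (𝓝 0) := by
    have := tendsto_sum_range_inv_succ_div_log.mul tendsto_log_div_succ
    rw [mul_zero] at this
    refine this.congr' ?_
    filter_upwards [eventually_ge_atTop 2] with n hn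
    have : (0 : ℝ) < Real.log n := Real.log_pos (by exact_mod_cast hn)
    rw [div_mul_div_cancel₀ this.ne']
  have hzn : Tendsto (fun n : ℕ => e n * (z n / ((n : ℝ) + 1))) atTop (𝓝 0) := by
    have h0 := hHn.const_mul K
    rw [mul_zero] at h0
    refine squeeze_zero_norm (fun n => ?_) h0
    rw [norm_mul, Real.norm_of_nonneg (he0 n)]
    refine (mul_le_of_le_one_left (norm_nonneg _) (he1 n)).trans ?_
    rw [norm_div, Real.norm_eq_abs, Real.norm_of_nonneg (by positivity : (0 : ℝ) ≤ (n : ℝ) + 1),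
      mul_div_assoc']
    gcongr
    exact hzH n
  have hsum : ∀ n, z n = ∑ k ∈ Finset.range n,
      (g k - e k * (z k / ((k : ℝ) + 1))) / ((k : ℝ) + 1) := by
    intro n
    induction n with
    | zero => simpa using hz0
    | succ n ih => rw [Finset.sum_range_succ, ← ih, hrec]; field_simp; ring
  have hfin := tendsto_sum_range_div_succ_div_log (hg.sub hzn)
  rw [sub_zero] at hfin
  refine hfin.congr fun n => ?_
  rw [← hsum, hz, div_div]

/-! ### Products of growth factors -/

/-- The product of the growth factors `1 + β / (j + 1)` over `k ≤ j < n`. -/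
noncomputable def urnProdIco (β : ℝ) (k n : ℕ) : ℝ :=
  ∏ j ∈ Finset.Ico k n, (1 + β / ((j : ℝ) + 1))

theorem urnProdIco_self (β : ℝ) (n : ℕ) : urnProdIco β n n = 1 := by simp [urnProdIco]

theorem urnProdIco_succ_right (β : ℝ) {k n : ℕ} (h : k ≤ n) :
    urnProdIco β k (n + 1) = urnProdIco β k n * (1 + β / ((n : ℝ) + 1)) :=
  Finset.prod_Ico_succ_top h _

theorem urnProdIco_eq_mul (β : ℝ) {k n : ℕ} (h : k < n) :
    urnProdIco β k n = (1 + β / ((k : ℝ) + 1)) * urnProdIco β (k + 1) n :=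
  Finset.prod_eq_prod_Ico_succ_bot h _

/-- Identifies the variance sums as solutions of the scalar recursions above, so no asymptotics of
the individual products are needed there. -/
theorem sum_urnProdIco_sq_succ (β : ℝ) (g : ℕ → ℝ) (n : ℕ) :
    ∑ k ∈ Finset.range (n + 1), urnProdIco β (k + 1) (n + 1) ^ 2 * g k =
      (1 + β / ((n : ℝ) + 1)) ^ 2 * ∑ k ∈ Finset.range n, urnProdIco β (k + 1) n ^ 2 * g k
        + g n := by
  rw [Finset.sum_range_succ, urnProdIco_self, Finset.mul_sum]
  congr 1
  · refine Finset.sum_congr rfl fun k hk => ?_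
    rw [urnProdIco_succ_right β (Finset.mem_range.1 hk)]
    ring
  · ring

/-- The condition β ≥ -1 makes every factor nonnegative, so each is at most exp(max β 0/(j+1)); the
harmonic sum is at most 1 + log n. The bound is uniform in k. -/
theorem abs_urnProdIco_le {β : ℝ} (hβ : -1 ≤ β) (k n : ℕ) (hn : 1 ≤ n) :
    |urnProdIco β k n| ≤ Real.exp (max β 0) * (n : ℝ) ^ (max β 0) := by
  have hn0 : (0 : ℝ) < n := by exact_mod_cast hn
  have h1 : ∀ j : ℕ, |1 + β / ((j : ℝ) + 1)| ≤ Real.exp (max β 0 * ((j : ℝ) + 1)⁻¹) := by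
    intro j
    have hj : (0 : ℝ) < (j : ℝ) + 1 := by positivity
    have h0 : 0 ≤ 1 + β / ((j : ℝ) + 1) := by
      have : -1 ≤ β / ((j : ℝ) + 1) := by
        rw [le_div_iff₀ hj]; have : (0 : ℝ) ≤ j := by positivity
        linarith
      linarith
    rw [abs_of_nonneg h0, div_eq_mul_inv]
    have h2 : β * ((j : ℝ) + 1)⁻¹ ≤ max β 0 * ((j : ℝ) + 1)⁻¹ := by
      gcongr; exact le_max_left _ _
    have := Real.add_one_le_exp (max β 0 * ((j : ℝ) + 1)⁻¹)
    linarith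
  have h2 : ∑ j ∈ Finset.range n, ((j : ℝ) + 1)⁻¹ ≤ 1 + Real.log n := by
    have := harmonic_le_one_add_log n
    simpa [harmonic] using this
  calc |urnProdIco β k n| = ∏ j ∈ Finset.Ico k n, |1 + β / ((j : ℝ) + 1)| := Finset.abs_prod _ _
    _ ≤ ∏ j ∈ Finset.Ico k n, Real.exp (max β 0 * ((j : ℝ) + 1)⁻¹) :=
      Finset.prod_le_prod (fun _ _ => abs_nonneg _) fun j _ => h1 j
    _ = Real.exp (∑ j ∈ Finset.Ico k n, max β 0 * ((j : ℝ) + 1)⁻¹) := (Real.exp_sum _ _).symm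
    _ ≤ Real.exp (∑ j ∈ Finset.range n, max β 0 * ((j : ℝ) + 1)⁻¹) := by
      refine Real.exp_le_exp.2 (Finset.sum_le_sum_of_subset_of_nonneg ?_ fun j _ _ => by positivity)
      intro j hj; simp at hj ⊢; omega
    _ ≤ Real.exp (max β 0 * (1 + Real.log n)) := by
      rw [← Finset.mul_sum]
      gcongr
    _ = _ := by
      rw [mul_add, mul_one, Real.exp_add, Real.rpow_def_of_pos hn0, mul_comm (Real.log _)]

theorem urnProd_succ (n : ℕ) (t : ℝ) :
    urnProd (n + 1) t = urnProd n t * (1 + t / ((n : ℝ) + 1)) :=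
  Finset.prod_range_succ _ _

theorem urnProd_pos {t : ℝ} (ht : 0 < t) (n : ℕ) : 0 < urnProd n t :=
  Finset.prod_pos fun _ _ => by positivity

/-- The product of t + j over j ≤ n is t n! Π_n(t), so this is Euler's limit formula for Γ,
inverted. -/
theorem tendsto_urnProd_div_rpow {t : ℝ} (ht : 0 < t) :
    Tendsto (fun n : ℕ => urnProd n t / (n : ℝ) ^ t) atTop (𝓝 (t * Real.Gamma t)⁻¹) := by
  have hG : 0 < Real.Gamma t := Real.Gamma_pos_of_pos ht
  have h := ((Real.GammaSeq_tendsto_Gamma t).const_mul t).inv₀ (by positivity)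
  refine h.congr fun n => ?_
  have hprod : ∏ j ∈ Finset.range (n + 1), (t + j) = t * (n.factorial * urnProd n t) := by
    rw [Finset.prod_range_succ']
    have : ∏ k ∈ Finset.range n, (t + ((k + 1 : ℕ) : ℝ)) = n.factorial * urnProd n t := by
      induction n with
      | zero => simp [urnProd]
      | succ n ih =>
        rw [Finset.prod_range_succ, ih, urnProd_succ, Nat.factorial_succ]
        push_cast
        field_simp
        ring
    rw [this]; push_cast; ring
  have hf : (n.factorial : ℝ) ≠ 0 := by exact_mod_cast n.factorial_ne_zero
  have hu := (urnProd_pos ht n).ne'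
  rw [Real.GammaSeq, hprod]
  field_simp

/-! ### Urn contents, proportions and conditional draws -/

section Urn

variable {Ω ι : Type*} [Fintype ι]
  {R : Matrix ι ι ℝ} {c₀ : ι → ℝ} {X : ℕ → Ω → ι}

theorem urnContents_nonneg [DecidableEq ι] (hR : R ∈ Matrix.rowStochastic ℝ ι)
    (hc₀ : c₀ ∈ stdSimplex ℝ ι)
    (n : ℕ) (ω : Ω) (i : ι) : 0 ≤ urnContents R c₀ X n ω i := by
  induction n with
  | zero => exact hc₀.1 i
  | succ n ih => exact add_nonneg ih (Matrix.nonneg_of_mem_rowStochastic hR)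

theorem sum_urnContents [DecidableEq ι] (hR : R ∈ Matrix.rowStochastic ℝ ι)
    (hc₀ : c₀ ∈ stdSimplex ℝ ι)
    (n : ℕ) (ω : Ω) : ∑ i, urnContents R c₀ X n ω i = n + 1 := by
  induction n with
  | zero => simpa [urnContents] using hc₀.2
  | succ n ih =>
    have := Matrix.sum_row_of_mem_rowStochastic hR (X n ω)
    simp only [urnContents, Pi.add_apply, Finset.sum_add_distrib, ih, this]
    push_cast; ring

/-- The proportion of colour `i` among the balls after `n` trials. -/
noncomputable def urnProp (R : Matrix ι ι ℝ) (c₀ : ι → ℝ) (X : ℕ → Ω → ι) (n : ℕ) (ω : Ω)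
    (i : ι) : ℝ :=
  urnContents R c₀ X n ω i / ((n : ℝ) + 1)

theorem urnProp_nonneg [DecidableEq ι] (hR : R ∈ Matrix.rowStochastic ℝ ι)
    (hc₀ : c₀ ∈ stdSimplex ℝ ι)
    (n : ℕ) (ω : Ω) (i : ι) : 0 ≤ urnProp R c₀ X n ω i :=
  div_nonneg (urnContents_nonneg hR hc₀ n ω i) (by positivity)

theorem sum_urnProp [DecidableEq ι] (hR : R ∈ Matrix.rowStochastic ℝ ι)
    (hc₀ : c₀ ∈ stdSimplex ℝ ι)
    (n : ℕ) (ω : Ω) : ∑ i, urnProp R c₀ X n ω i = 1 := by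
  simp only [urnProp]
  rw [← Finset.sum_div, sum_urnContents hR hc₀, div_self (by positivity)]

theorem sum_urnProp_mul (w : ι → ℝ) (n : ℕ) (ω : Ω) :
    ∑ i, urnProp R c₀ X n ω i * w i = (urnContents R c₀ X n ω ⬝ᵥ w) / ((n : ℝ) + 1) := by
  simp only [urnProp, dotProduct, Finset.sum_div]
  exact Finset.sum_congr rfl fun i _ => by ring

theorem urnContents_succ_dotProduct {w : ι → ℝ} {l : ℝ} (hw : R *ᵥ w = l • w) (n : ℕ) (ω : Ω) :
    urnContents R c₀ X (n + 1) ω ⬝ᵥ w = urnContents R c₀ X n ω ⬝ᵥ w + l * w (X n ω) := by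
  have h : R (X n ω) ⬝ᵥ w = l * w (X n ω) := congrFun hw (X n ω)
  rw [← h, ← add_dotProduct]
  rfl

theorem abs_urnContents_dotProduct_le [DecidableEq ι] (hR : R ∈ Matrix.rowStochastic ℝ ι)
    (hc₀ : c₀ ∈ stdSimplex ℝ ι) {w : ι → ℝ} {K : ℝ} (hw : ∀ i, |w i| ≤ K) (n : ℕ) (ω : Ω) :
    |urnContents R c₀ X n ω ⬝ᵥ w| ≤ ((n : ℝ) + 1) * K := by
  calc |urnContents R c₀ X n ω ⬝ᵥ w| ≤ ∑ i, |urnContents R c₀ X n ω i * w i| :=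
        Finset.abs_sum_le_sum_abs _ _
    _ ≤ ∑ i, urnContents R c₀ X n ω i * K := by
        refine Finset.sum_le_sum fun i _ => ?_
        rw [abs_mul, abs_of_nonneg (urnContents_nonneg hR hc₀ n ω i)]
        exact mul_le_mul_of_nonneg_left (hw i) (urnContents_nonneg hR hc₀ n ω i)
    _ = _ := by rw [← Finset.sum_mul, sum_urnContents hR hc₀]

variable [MeasurableSpace Ω]

theorem measurable_urnFiltration_urnContents (hX : ∀ n i, MeasurableSet (X n ⁻¹' {i})) (n : ℕ) :
    Measurable[urnFiltration R c₀ X hX n] (urnContents R c₀ X n) :=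
  (Filtration.stronglyAdapted_natural
    (fun n => (measurable_urnContents R c₀ X hX n).stronglyMeasurable) n).measurable

theorem measurable_urnFiltration_dotProduct (hX : ∀ n i, MeasurableSet (X n ⁻¹' {i}))
    (w : ι → ℝ) (n : ℕ) :
    Measurable[urnFiltration R c₀ X hX n] (fun ω => urnContents R c₀ X n ω ⬝ᵥ w) :=
  (by unfold dotProduct; fun_prop : Measurable fun c : ι → ℝ => c ⬝ᵥ w).comp
    (measurable_urnFiltration_urnContents hX n)

theorem measurable_dotProduct (hX : ∀ n i, MeasurableSet (X n ⁻¹' {i}))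
    (w : ι → ℝ) (n : ℕ) : Measurable (fun ω => urnContents R c₀ X n ω ⬝ᵥ w) :=
  (measurable_urnFiltration_dotProduct (R := R) (c₀ := c₀) hX w n).mono
    ((urnFiltration R c₀ X hX).le n) le_rfl

theorem measurable_comp_draw {E : Type*} [MeasurableSpace E]
    (hX : ∀ n i, MeasurableSet (X n ⁻¹' {i})) (F : ι → E) (n : ℕ) :
    Measurable (fun ω => F (X n ω)) := by
  let _ : MeasurableSpace ι := ⊤
  exact (measurable_from_top (f := F)).comp (measurable_to_countable' (hX n))

theorem measurable_urnProp (hX : ∀ n i, MeasurableSet (X n ⁻¹' {i})) (n : ℕ) (i : ι) :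
    Measurable (fun ω => urnProp R c₀ X n ω i) :=
  ((measurable_pi_apply i).comp (measurable_urnContents R c₀ X hX n)).div_const _

variable {μ : Measure Ω} [IsProbabilityMeasure μ]

theorem integrable_dotProduct [DecidableEq ι] (hR : R ∈ Matrix.rowStochastic ℝ ι)
    (hc₀ : c₀ ∈ stdSimplex ℝ ι)
    (hX : ∀ n i, MeasurableSet (X n ⁻¹' {i})) (w : ι → ℝ) (n : ℕ) :
    Integrable (fun ω => urnContents R c₀ X n ω ⬝ᵥ w) μ := by
  refine Integrable.of_bound (measurable_dotProduct hX w n).aestronglyMeasurable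
    (((n : ℝ) + 1) * ‖w‖) (Eventually.of_forall fun ω => ?_)
  exact abs_urnContents_dotProduct_le hR hc₀ (fun i => norm_le_pi_norm w i) n ω

/-- The defining property of the draws, integrated against functions of the past. -/
theorem IsUrnDraws.integral_mul_draw {𝕜 : Type*} [RCLike 𝕜] (hX : IsUrnDraws μ R c₀ X)
    {n : ℕ} {g : Ω → 𝕜}
    (hg : StronglyMeasurable[urnFiltration R c₀ X hX.measurableSet_draw n] g)
    {K : ℝ} (hK : ∀ ω, ‖g ω‖ ≤ K) (F : ι → 𝕜) :
    ∫ ω, g ω * F (X n ω) ∂μ = ∫ ω, g ω * ∑ i, (urnProp R c₀ X n ω i : 𝕜) * F i ∂μ := by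
  set ℱ := urnFiltration R c₀ X hX.measurableSet_draw with hℱ
  have hm : ℱ n ≤ _ := ℱ.le n
  have hg0 : AEStronglyMeasurable g μ := (hg.mono hm).aestronglyMeasurable
  have hgi : Integrable g μ := Integrable.of_bound hg0 K (Eventually.of_forall hK)
  set I : ι → Ω → ℝ := fun i => (X n ⁻¹' {i}).indicator (fun _ => (1 : ℝ)) with hI
  have hIi : ∀ i, Integrable (I i) μ := fun i =>
    (integrable_const (1 : ℝ)).indicator (hX.measurableSet_draw n i)
  have hIgi : ∀ i, Integrable (I i • g) μ := fun i => by
    have : I i • g = (X n ⁻¹' {i}).indicator g := by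
      ext ω; by_cases h : ω ∈ X n ⁻¹' {i} <;> simp [hI, h]
    rw [this]
    exact hgi.indicator (hX.measurableSet_draw n i)
  have hce : ∀ i, μ[I i • g | ℱ n] =ᵐ[μ] (fun ω => urnProp R c₀ X n ω i) • g := fun i =>
    (condExp_smul_of_aestronglyMeasurable_right (hIi i) (hIgi i) hg.aestronglyMeasurable).trans
      ((hX.condProb_draw n i).smul EventuallyEq.rfl)
  have hkey : ∀ i, ∫ ω, (I i • g) ω ∂μ = ∫ ω, (urnProp R c₀ X n ω i : 𝕜) * g ω ∂μ := fun i => by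
    rw [← integral_condExp hm, integral_congr_ae (hce i)]
    refine integral_congr_ae (Eventually.of_forall fun ω => ?_)
    simp [RCLike.real_smul_eq_coe_mul]
  have hPgi : ∀ i, Integrable (fun ω => (urnProp R c₀ X n ω i : 𝕜) * g ω) μ := fun i => by
    refine ((integrable_condExp (m := ℱ n)).congr (hce i)).congr (Eventually.of_forall fun ω => ?_)
    simp [RCLike.real_smul_eq_coe_mul]
  have e1 : ∀ ω, g ω * F (X n ω) = ∑ i, F i * (I i • g) ω := by
    intro ω
    rw [Finset.sum_eq_single (X n ω)]
    · simp [hI, mul_comm]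
    · intro i _ hi
      simp [hI, Ne.symm hi]
    · simp
  have e2 : ∀ ω, g ω * ∑ i, (urnProp R c₀ X n ω i : 𝕜) * F i =
      ∑ i, F i * ((urnProp R c₀ X n ω i : 𝕜) * g ω) := by
    intro ω
    rw [Finset.mul_sum]
    exact Finset.sum_congr rfl fun i _ => by ring
  simp_rw [e1, e2]
  rw [integral_finsetSum _ fun i _ => (hIgi i).const_mul _,
    integral_finsetSum _ fun i _ => (hPgi i).const_mul _]
  refine Finset.sum_congr rfl fun i _ => ?_
  rw [integral_const_mul, integral_const_mul, hkey]

theorem IsUrnDraws.integral_draw (hX : IsUrnDraws μ R c₀ X) (n : ℕ) (F : ι → ℝ) :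
    ∫ ω, F (X n ω) ∂μ = ∫ ω, ∑ i, urnProp R c₀ X n ω i * F i ∂μ := by
  have := hX.integral_mul_draw (n := n) (g := fun _ => (1 : ℝ)) stronglyMeasurable_const
    (K := 1) (by simp) F
  simpa using this

theorem IsUrnDraws.condExp_draw (hX : IsUrnDraws μ R c₀ X) (n : ℕ) (F : ι → ℝ) :
    μ[fun ω => F (X n ω) | urnFiltration R c₀ X hX.measurableSet_draw n] =ᵐ[μ]
      fun ω => (urnContents R c₀ X n ω ⬝ᵥ F) / ((n : ℝ) + 1) := by
  have e1 : (fun ω => F (X n ω)) =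
      ∑ i, F i • (X n ⁻¹' {i}).indicator (fun _ => (1 : ℝ)) := by
    ext ω
    rw [Finset.sum_apply, Finset.sum_eq_single (X n ω)]
    · simp
    · intro i _ hi
      simp [Ne.symm hi]
    · simp
  rw [e1]
  refine (condExp_finsetSum (fun i _ => (((integrable_const (1 : ℝ)).indicator
    (hX.measurableSet_draw n i)).smul (F i))) _).trans ?_
  have h := fun i => (condExp_smul (μ := μ) (F i) ((X n ⁻¹' {i}).indicator (fun _ => (1 : ℝ)))
    (urnFiltration R c₀ X hX.measurableSet_draw n))
  have h2 := fun i => hX.condProb_draw n i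
  filter_upwards [ae_all_iff.2 h, ae_all_iff.2 h2] with ω h h2
  rw [Finset.sum_apply, ← sum_urnProp_mul]
  refine Finset.sum_congr rfl fun i _ => ?_
  rw [h, Pi.smul_apply, h2, smul_eq_mul, mul_comm]
  rfl

end Urn

/-! ### Moments along eigenvectors and the law of large numbers -/

theorem sq_integral_abs_le {Ω : Type*} [MeasurableSpace Ω] {μ : Measure Ω} [IsProbabilityMeasure μ]
    {f : Ω → ℝ} (hf : Integrable f μ) (hf2 : Integrable (fun ω => f ω ^ 2) μ) :
    (∫ ω, |f ω| ∂μ) ^ 2 ≤ ∫ ω, f ω ^ 2 ∂μ := by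
  set c := ∫ ω, |f ω| ∂μ with hc
  have h0 : 0 ≤ ∫ ω, (f ω ^ 2 - 2 * c * |f ω| + c ^ 2) ∂μ := by
    refine integral_nonneg fun ω => ?_
    have : f ω ^ 2 - 2 * c * |f ω| + c ^ 2 = (|f ω| - c) ^ 2 := by
      rw [← sq_abs (f ω)]; ring
    simp only [Pi.zero_apply, this]
    positivity
  have hi : Integrable (fun ω => 2 * c * |f ω|) μ := hf.abs.const_mul _
  have hi2 : Integrable (fun ω => f ω ^ 2 - 2 * c * |f ω|) μ := hf2.sub hi
  rw [integral_add hi2 (integrable_const _), integral_sub hf2 hi,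
    integral_const_mul, ← hc] at h0
  simp only [integral_const, probReal_univ, one_smul] at h0
  nlinarith

section Urn

variable {Ω ι : Type*} [Fintype ι] [DecidableEq ι] [MeasurableSpace Ω]
  {R : Matrix ι ι ℝ} {c₀ : ι → ℝ} {X : ℕ → Ω → ι}
  {μ : Measure Ω} [IsProbabilityMeasure μ]

theorem integrable_dotProduct_sq (hR : R ∈ Matrix.rowStochastic ℝ ι) (hc₀ : c₀ ∈ stdSimplex ℝ ι)
    (hX : ∀ n i, MeasurableSet (X n ⁻¹' {i})) (w : ι → ℝ) (n : ℕ) :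
    Integrable (fun ω => (urnContents R c₀ X n ω ⬝ᵥ w) ^ 2) μ := by
  refine Integrable.of_bound ((measurable_dotProduct hX w n).pow_const 2).aestronglyMeasurable
    ((((n : ℝ) + 1) * ‖w‖) ^ 2) (Eventually.of_forall fun ω => ?_)
  rw [norm_pow]
  exact pow_le_pow_left₀ (norm_nonneg _)
    (abs_urnContents_dotProduct_le hR hc₀ (fun i => norm_le_pi_norm w i) n ω) 2

omit [DecidableEq ι] in
theorem integrable_comp_draw (hX : ∀ n i, MeasurableSet (X n ⁻¹' {i})) (F : ι → ℝ) (n : ℕ) :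
    Integrable (fun ω => F (X n ω)) μ :=
  Integrable.of_bound (measurable_comp_draw hX F n).aestronglyMeasurable ‖F‖
    (Eventually.of_forall fun ω => norm_le_pi_norm F (X n ω))

theorem IsUrnDraws.integral_dotProduct_succ (hX : IsUrnDraws μ R c₀ X)
    (hR : R ∈ Matrix.rowStochastic ℝ ι) (hc₀ : c₀ ∈ stdSimplex ℝ ι) {w : ι → ℝ} {l : ℝ}
    (hw : R *ᵥ w = l • w) (n : ℕ) :
    ∫ ω, urnContents R c₀ X (n + 1) ω ⬝ᵥ w ∂μ =
      (1 + l / ((n : ℝ) + 1)) * ∫ ω, urnContents R c₀ X n ω ⬝ᵥ w ∂μ := by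
  simp_rw [urnContents_succ_dotProduct hw]
  rw [integral_add (integrable_dotProduct hR hc₀ hX.measurableSet_draw w n)
    ((integrable_comp_draw hX.measurableSet_draw w n).const_mul l), integral_const_mul,
    hX.integral_draw]
  simp_rw [sum_urnProp_mul]
  rw [integral_div]
  ring

/-- In the cross term, conditioning on the past replaces w (X n) by its mean, C_n w/(n+1). -/
theorem IsUrnDraws.integral_dotProduct_sq_succ (hX : IsUrnDraws μ R c₀ X)
    (hR : R ∈ Matrix.rowStochastic ℝ ι) (hc₀ : c₀ ∈ stdSimplex ℝ ι) {w : ι → ℝ} {l : ℝ}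
    (hw : R *ᵥ w = l • w) (n : ℕ) :
    ∫ ω, (urnContents R c₀ X (n + 1) ω ⬝ᵥ w) ^ 2 ∂μ =
      (1 + 2 * l / ((n : ℝ) + 1)) * ∫ ω, (urnContents R c₀ X n ω ⬝ᵥ w) ^ 2 ∂μ
        + l ^ 2 * ∫ ω, w (X n ω) ^ 2 ∂μ := by
  have hm := hX.measurableSet_draw
  set Y : Ω → ℝ := fun ω => urnContents R c₀ X n ω ⬝ᵥ w with hY
  have hYb : ∀ ω, ‖Y ω‖ ≤ ((n : ℝ) + 1) * ‖w‖ :=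
    abs_urnContents_dotProduct_le hR hc₀ (fun i => norm_le_pi_norm w i) n
  have hYs : StronglyMeasurable[urnFiltration R c₀ X hm n] Y :=
    (measurable_urnFiltration_dotProduct hm w n).stronglyMeasurable
  have h1 := integrable_dotProduct_sq (μ := μ) hR hc₀ hm w n
  have h2 : Integrable (fun ω => Y ω * w (X n ω)) μ :=
    (integrable_comp_draw hm w n).bdd_mul (measurable_dotProduct hm w n).aestronglyMeasurable
      (Eventually.of_forall hYb)
  have h3 : Integrable (fun ω => w (X n ω) ^ 2) μ := integrable_comp_draw hm (fun i => w i ^ 2) n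
  have e1 : ∀ ω, (urnContents R c₀ X (n + 1) ω ⬝ᵥ w) ^ 2 =
      Y ω ^ 2 + 2 * l * (Y ω * w (X n ω)) + l ^ 2 * w (X n ω) ^ 2 := by
    intro ω; rw [urnContents_succ_dotProduct hw]; ring
  have e2 : ∫ ω, Y ω * w (X n ω) ∂μ = (∫ ω, Y ω ^ 2 ∂μ) / ((n : ℝ) + 1) := by
    rw [hX.integral_mul_draw hYs hYb w, ← integral_div]
    refine integral_congr_ae (Eventually.of_forall fun ω => ?_)
    simp only [RCLike.ofReal_real_eq_id, id_eq, sum_urnProp_mul, hY]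
    ring
  simp_rw [e1]
  have h4 : Integrable (fun ω => Y ω ^ 2 + 2 * l * (Y ω * w (X n ω))) μ :=
    h1.add (h2.const_mul _)
  rw [integral_add h4 (h3.const_mul _),
    integral_add h1 (h2.const_mul _), integral_const_mul, integral_const_mul, e2]
  ring

omit [Fintype ι] [DecidableEq ι] in
theorem integral_comp_draw_sq_le {w : ι → ℝ} {K : ℝ} (hK : ∀ i, |w i| ≤ K) (n : ℕ) :
    ∫ ω, w (X n ω) ^ 2 ∂μ ≤ K ^ 2 := by
  have h : ∀ ω, ‖w (X n ω) ^ 2‖ ≤ K ^ 2 := fun ω => by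
    rw [norm_pow]; exact pow_le_pow_left₀ (norm_nonneg _) (hK _) 2
  simpa using (le_abs_self _).trans (norm_integral_le_of_norm_le_const (μ := μ)
    (Eventually.of_forall h))

theorem IsUrnDraws.tendsto_integral_dotProduct_div (hX : IsUrnDraws μ R c₀ X)
    (hR : R ∈ Matrix.rowStochastic ℝ ι) (hc₀ : c₀ ∈ stdSimplex ℝ ι) {w : ι → ℝ} {l : ℝ}
    (hw : R *ᵥ w = l • w) (hw0 : ∀ i, 0 ≤ w i) (hl : l < 1) :
    Tendsto (fun n : ℕ => (∫ ω, urnContents R c₀ X n ω ⬝ᵥ w ∂μ) / ((n : ℝ) + 1)) atTop (𝓝 0) := by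
  have hnn : ∀ n, 0 ≤ ∫ ω, urnContents R c₀ X n ω ⬝ᵥ w ∂μ := fun n =>
    integral_nonneg fun ω => Finset.sum_nonneg fun i _ =>
      mul_nonneg (urnContents_nonneg hR hc₀ n ω i) (hw0 i)
  refine tendsto_zero_of_le_one_sub_div_mul (c := (1 - l) / 2) (by linarith)
    (fun n => div_nonneg (hnn n) (by positivity)) (Eventually.of_forall fun n => ?_)
  rw [hX.integral_dotProduct_succ hR hc₀ hw]
  set y := ∫ ω, urnContents R c₀ X n ω ⬝ᵥ w ∂μ with hy
  have hm : (0 : ℝ) < (n : ℝ) + 1 := by positivity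
  have hn0 : (0 : ℝ) ≤ n := by positivity
  -- The total mass after n + 1 trials is n + 2. The halved rate c pays for passing from 1/(n+2) to
  -- 1/(n+1).
  have e1 : (1 + l / ((n : ℝ) + 1)) * y / ((n + 1 : ℕ) + 1 : ℝ) =
      (1 - (1 - l) / ((n : ℝ) + 2)) * (y / ((n : ℝ) + 1)) := by
    push_cast
    have : (n : ℝ) + 2 ≠ 0 := by positivity
    have : (n : ℝ) + 1 + 1 ≠ 0 := by positivity
    field_simp
    ring
  rw [e1]
  refine mul_le_mul_of_nonneg_right ?_ (div_nonneg (hnn n) hm.le)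
  have : (1 - l) / 2 / ((n : ℝ) + 1) ≤ (1 - l) / ((n : ℝ) + 2) := by
    rw [div_div]
    exact div_le_div_of_nonneg_left (by linarith) (by positivity) (by linarith)
  linarith

theorem IsUrnDraws.tendsto_integral_dotProduct_sq_div (hX : IsUrnDraws μ R c₀ X)
    (hR : R ∈ Matrix.rowStochastic ℝ ι) (hc₀ : c₀ ∈ stdSimplex ℝ ι) {w : ι → ℝ} {l : ℝ}
    (hw : R *ᵥ w = l • w) (hl1 : -1 ≤ l) (hl : l < 1) :
    Tendsto (fun n : ℕ => (∫ ω, (urnContents R c₀ X n ω ⬝ᵥ w) ^ 2 ∂μ) / ((n : ℝ) + 1) ^ 2) atTop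
      (𝓝 0) := by
  have hnn : ∀ n, 0 ≤ ∫ ω, (urnContents R c₀ X n ω ⬝ᵥ w) ^ 2 ∂μ := fun n =>
    integral_nonneg fun ω => sq_nonneg _
  have hη : Tendsto (fun n : ℕ => l ^ 2 * ‖w‖ ^ 2 * ((n : ℝ) + 1)⁻¹) atTop (𝓝 0) := by
    simpa using tendsto_inv_succ.const_mul (l ^ 2 * ‖w‖ ^ 2)
  refine tendsto_zero_of_le_one_sub_div_mul_add (c := (1 - l) / 2) (by linarith)
    (fun n => div_nonneg (hnn n) (by positivity)) hη (Eventually.of_forall fun n => ?_)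
  rw [hX.integral_dotProduct_sq_succ hR hc₀ hw]
  have hB := integral_comp_draw_sq_le (μ := μ) (X := X) (fun i => norm_le_pi_norm w i) n
  set y := ∫ ω, (urnContents R c₀ X n ω ⬝ᵥ w) ^ 2 ∂μ with hy
  set B := ∫ ω, w (X n ω) ^ 2 ∂μ
  have hm : (0 : ℝ) < (n : ℝ) + 1 := by positivity
  have hm2 : (0 : ℝ) < (n : ℝ) + 2 := by positivity
  have hn0 : (0 : ℝ) ≤ n := by positivity
  -- With a = (1 - l)/(n+2) in [0, 1], the factor is at most (1 - a)² ≤ 1 - a; the forcing term is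
  -- O(1/(n+1)²).
  have e1 : ((1 + 2 * l / ((n : ℝ) + 1)) * y + l ^ 2 * B) / ((n + 1 : ℕ) + 1 : ℝ) ^ 2 =
      ((1 - (1 - l) / ((n : ℝ) + 2)) ^ 2 - (l / ((n : ℝ) + 2)) ^ 2) * (y / ((n : ℝ) + 1) ^ 2)
        + l ^ 2 * B / ((n : ℝ) + 2) ^ 2 := by
    push_cast
    rw [show (n : ℝ) + 1 + 1 = n + 2 by ring]
    field_simp
    ring
  rw [e1]
  set a := (1 - l) / ((n : ℝ) + 2) with ha
  have ha0 : 0 ≤ a := div_nonneg (by linarith) hm2.le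
  have ha1 : a ≤ 1 := by rw [ha, div_le_one hm2]; linarith
  have hca : (1 - l) / 2 / ((n : ℝ) + 1) ≤ a := by
    rw [div_div]
    exact div_le_div_of_nonneg_left (by linarith) (by positivity) (by linarith)
  refine add_le_add (mul_le_mul_of_nonneg_right ?_ (by positivity)) ?_
  · nlinarith [sq_nonneg (l / ((n : ℝ) + 2))]
  · calc l ^ 2 * B / ((n : ℝ) + 2) ^ 2 ≤ l ^ 2 * ‖w‖ ^ 2 / ((n : ℝ) + 1) ^ 2 := by
          gcongr; linarith
      _ = _ := by field_simp

theorem IsUrnDraws.tendsto_integral_abs_dotProduct_div (hX : IsUrnDraws μ R c₀ X)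
    (hR : R ∈ Matrix.rowStochastic ℝ ι) (hc₀ : c₀ ∈ stdSimplex ℝ ι) {w : ι → ℝ} {l : ℝ}
    (hw : R *ᵥ w = l • w) (hl1 : -1 ≤ l) (hl : l < 1) :
    Tendsto (fun n : ℕ => (∫ ω, |urnContents R c₀ X n ω ⬝ᵥ w| ∂μ) / ((n : ℝ) + 1)) atTop
      (𝓝 0) := by
  have h := (hX.tendsto_integral_dotProduct_sq_div hR hc₀ hw hl1 hl).sqrt
  rw [Real.sqrt_zero] at h
  refine squeeze_zero (fun n => by positivity) (fun n => ?_) h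
  refine Real.le_sqrt_of_sq_le ?_
  rw [div_pow]
  gcongr
  exact sq_integral_abs_le (integrable_dotProduct hR hc₀ hX.measurableSet_draw w n)
    (integrable_dotProduct_sq hR hc₀ hX.measurableSet_draw w n)

omit [DecidableEq ι] in
theorem measurable_sum_urnProp_mul (hX : ∀ n i, MeasurableSet (X n ⁻¹' {i})) (f : ι → ℝ) (n : ℕ) :
    Measurable (fun ω => ∑ i, urnProp R c₀ X n ω i * f i) :=
  Finset.measurable_fun_sum _ fun i _ => (measurable_urnProp hX n i).mul_const _

omit [MeasurableSpace Ω] in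
theorem abs_sum_urnProp_mul_le (hR : R ∈ Matrix.rowStochastic ℝ ι) (hc₀ : c₀ ∈ stdSimplex ℝ ι)
    {w : ι → ℝ} {K : ℝ} (hw : ∀ i, |w i| ≤ K) (n : ℕ) (ω : Ω) :
    |∑ i, urnProp R c₀ X n ω i * w i| ≤ K := by
  rw [sum_urnProp_mul, abs_div, abs_of_pos (by positivity : (0 : ℝ) < (n : ℝ) + 1),
    div_le_iff₀ (by positivity), mul_comm]
  exact abs_urnContents_dotProduct_le hR hc₀ hw n ω

theorem integrable_sum_urnProp_mul (hR : R ∈ Matrix.rowStochastic ℝ ι) (hc₀ : c₀ ∈ stdSimplex ℝ ι)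
    (hX : ∀ n i, MeasurableSet (X n ⁻¹' {i})) (f : ι → ℝ) (n : ℕ) :
    Integrable (fun ω => ∑ i, urnProp R c₀ X n ω i * f i) μ :=
  Integrable.of_bound (measurable_sum_urnProp_mul hX f n).aestronglyMeasurable ‖f‖
    (Eventually.of_forall fun ω =>
      abs_sum_urnProp_mul_le hR hc₀ (fun i => norm_le_pi_norm f i) n ω)

/-- Law of large numbers: averages over the colour proportions of a function which is
constant up to an eigenvector `v` and a multiple of a vanishing nonnegative eigenvector `w`. -/
theorem IsUrnDraws.tendsto_integral_abs_sum_urnProp_sub (hX : IsUrnDraws μ R c₀ X)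
    (hR : R ∈ Matrix.rowStochastic ℝ ι) (hc₀ : c₀ ∈ stdSimplex ℝ ι) {w v f : ι → ℝ}
    {l β θ κ D : ℝ} (hw : R *ᵥ w = l • w) (hw0 : ∀ i, 0 ≤ w i) (hl : l < 1)
    (hv : R *ᵥ v = β • v) (hβ1 : -1 ≤ β) (hβ : β < 1)
    (hf : ∀ i, |f i - θ - κ * v i| ≤ D * w i) :
    Tendsto (fun n : ℕ => ∫ ω, |∑ i, urnProp R c₀ X n ω i * f i - θ| ∂μ) atTop (𝓝 0) := by
  have hm := hX.measurableSet_draw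
  have h := ((hX.tendsto_integral_abs_dotProduct_div hR hc₀ hv hβ1 hβ).const_mul |κ|).add
    ((hX.tendsto_integral_dotProduct_div hR hc₀ hw hw0 hl).const_mul D)
  simp only [mul_zero, add_zero] at h
  refine squeeze_zero (fun n => integral_nonneg fun ω => abs_nonneg _) (fun n => ?_) h
  have hb : ∀ ω, |∑ i, urnProp R c₀ X n ω i * f i - θ| ≤
      |κ| / ((n : ℝ) + 1) * |urnContents R c₀ X n ω ⬝ᵥ v| +
        D / ((n : ℝ) + 1) * (urnContents R c₀ X n ω ⬝ᵥ w) := by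
    intro ω
    have e1 : ∑ i, urnProp R c₀ X n ω i * f i - θ =
        κ * ∑ i, urnProp R c₀ X n ω i * v i +
          ∑ i, urnProp R c₀ X n ω i * (f i - θ - κ * v i) := by
      have : ∑ i, urnProp R c₀ X n ω i * (f i - θ - κ * v i) =
          ∑ i, urnProp R c₀ X n ω i * f i - (∑ i, urnProp R c₀ X n ω i) * θ -
            κ * ∑ i, urnProp R c₀ X n ω i * v i := by
        rw [Finset.sum_mul, Finset.mul_sum, ← Finset.sum_sub_distrib, ← Finset.sum_sub_distrib]
        exact Finset.sum_congr rfl fun i _ => by ring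
      rw [this, sum_urnProp hR hc₀]; ring
    have e2 : |∑ i, urnProp R c₀ X n ω i * (f i - θ - κ * v i)| ≤
        D * ∑ i, urnProp R c₀ X n ω i * w i := by
      rw [Finset.mul_sum]
      refine (Finset.abs_sum_le_sum_abs _ _).trans (Finset.sum_le_sum fun i _ => ?_)
      have h0 := urnProp_nonneg hR hc₀ (X := X) n ω i
      rw [abs_mul, abs_of_nonneg h0]
      calc _ ≤ urnProp R c₀ X n ω i * (D * w i) := mul_le_mul_of_nonneg_left (hf i) h0
        _ = _ := by ring
    rw [e1]
    refine (abs_add_le _ _).trans (add_le_add (le_of_eq ?_) (e2.trans (le_of_eq ?_)))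
    · rw [abs_mul, sum_urnProp_mul, abs_div, abs_of_pos (by positivity : (0 : ℝ) < (n : ℝ) + 1)]
      ring
    · rw [sum_urnProp_mul]; ring
  have i1 : Integrable (fun ω => |κ| / ((n : ℝ) + 1) * |urnContents R c₀ X n ω ⬝ᵥ v|) μ :=
    (integrable_dotProduct hR hc₀ hm v n).abs.const_mul _
  have i2 : Integrable (fun ω => D / ((n : ℝ) + 1) * (urnContents R c₀ X n ω ⬝ᵥ w)) μ :=
    (integrable_dotProduct hR hc₀ hm w n).const_mul _
  calc _ ≤ _ := integral_mono
        ((integrable_sum_urnProp_mul hR hc₀ hm f n).sub (integrable_const θ)).abs (i1.add i2) hb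
    _ = _ := by
      simp only [Pi.add_apply]
      rw [integral_add i1 i2, integral_const_mul, integral_const_mul]
      ring

end Urn

/-! ### Gaussian replacement in characteristic functions -/

theorem norm_cexp_sub_quadratic_le {z : ℂ} (hz : ‖z‖ ≤ 1) :
    ‖Complex.exp z - (1 + z + z ^ 2 / 2)‖ ≤ ‖z‖ ^ 3 := by
  have h := Complex.exp_bound hz (n := 3) (by norm_num)
  have e : ∑ m ∈ Finset.range 3, z ^ m / (m.factorial : ℂ) = 1 + z + z ^ 2 / 2 := by
    simp [Finset.sum_range_succ, Nat.factorial]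
  rw [e] at h
  refine h.trans (mul_le_of_le_one_right (by positivity) ?_)
  norm_num [Nat.factorial]

/-- Second order comparison of the characteristic function of a law with finite support and
that of a Gaussian law with the same mean. -/
theorem norm_sum_mul_cexp_sub_le {ι : Type*} [Fintype ι] {p x : ι → ℝ} {K θ a : ℝ}
    (hp : ∀ i, 0 ≤ p i) (hp1 : ∑ i, p i = 1) (hx : ∀ i, |x i| ≤ K) (hθ : 0 ≤ θ) (hθK : θ ≤ K ^ 2)
    (ha : |a| * K ≤ 1 / 2) :
    ‖∑ i, (p i : ℂ) * Complex.exp (a * x i * Complex.I) -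
        Complex.exp (a * (∑ i, p i * x i : ℝ) * Complex.I - (a ^ 2 * θ / 2 : ℝ))‖ ≤
      a ^ 2 * (|∑ i, p i * x i ^ 2 - θ| + (∑ i, p i * x i) ^ 2) + 10 * (|a| * K) ^ 3 := by
  set m := ∑ i, p i * x i with hm
  set q := ∑ i, p i * x i ^ 2 with hq
  have hne : (Finset.univ : Finset ι).Nonempty := by
    by_contra h
    rw [Finset.not_nonempty_iff_eq_empty] at h
    simp [h] at hp1
  have hK : 0 ≤ K := by
    obtain ⟨i, -⟩ := hne
    exact (abs_nonneg _).trans (hx i)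
  have hmK : |m| ≤ K := by
    calc |m| ≤ ∑ i, |p i * x i| := Finset.abs_sum_le_sum_abs _ _
      _ ≤ ∑ i, p i * K := Finset.sum_le_sum fun i _ => by
        rw [abs_mul, abs_of_nonneg (hp i)]
        exact mul_le_mul_of_nonneg_left (hx i) (hp i)
      _ = K := by rw [← Finset.sum_mul, hp1, one_mul]
  have haK : 0 ≤ |a| * K := by positivity
  set z : ℂ := a * m * Complex.I - (a ^ 2 * θ / 2 : ℝ) with hz
  have hzn : ‖z‖ ≤ 2 * (|a| * K) := by
    calc ‖z‖ ≤ ‖(a * m * Complex.I : ℂ)‖ + ‖((a ^ 2 * θ / 2 : ℝ) : ℂ)‖ := norm_sub_le _ _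
      _ = |a| * |m| + a ^ 2 * θ / 2 := by
        rw [Complex.norm_real, Real.norm_of_nonneg (by positivity)]
        simp
      _ ≤ |a| * K + (|a| * K) ^ 2 := by
        refine add_le_add (by gcongr) ?_
        rw [mul_pow, sq_abs]
        have : a ^ 2 * θ ≤ a ^ 2 * K ^ 2 := by gcongr
        have : 0 ≤ a ^ 2 * K ^ 2 := by positivity
        linarith
      _ ≤ _ := by nlinarith
  -- The final constant is 10 = 1 + 8 + 1: the Taylor error of the discrete law, that of exp z with
  -- ‖z‖ ≤ 2|a|K, and the higher-order part of the difference of the two quadratic polynomials.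
  have h1 : ‖∑ i, (p i : ℂ) * (Complex.exp (a * x i * Complex.I) -
      (1 + a * x i * Complex.I + (a * x i * Complex.I) ^ 2 / 2))‖ ≤ (|a| * K) ^ 3 := by
    calc _ ≤ ∑ i, ‖(p i : ℂ) * (Complex.exp (a * x i * Complex.I) -
          (1 + a * x i * Complex.I + (a * x i * Complex.I) ^ 2 / 2))‖ := norm_sum_le _ _
      _ ≤ ∑ i, p i * (|a| * K) ^ 3 := by
        refine Finset.sum_le_sum fun i _ => ?_
        have hn : ‖(a * x i * Complex.I : ℂ)‖ ≤ |a| * K := by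
          simp only [norm_mul, Complex.norm_real, Real.norm_eq_abs, Complex.norm_I, mul_one]
          gcongr
          exact hx i
        rw [norm_mul, Complex.norm_real, Real.norm_of_nonneg (hp i)]
        refine mul_le_mul_of_nonneg_left ?_ (hp i)
        exact (norm_cexp_sub_quadratic_le (by linarith)).trans (by gcongr)
      _ = _ := by rw [← Finset.sum_mul, hp1, one_mul]
  have h2 : ‖Complex.exp z - (1 + z + z ^ 2 / 2)‖ ≤ 8 * (|a| * K) ^ 3 := by
    refine (norm_cexp_sub_quadratic_le (by linarith)).trans ?_
    calc ‖z‖ ^ 3 ≤ (2 * (|a| * K)) ^ 3 := by gcongr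
      _ = _ := by ring
  have h3 : ‖((-(a ^ 2 * (q - θ) / 2) + a ^ 2 * m ^ 2 / 2 - a ^ 4 * θ ^ 2 / 8 : ℝ) : ℂ)
      + ((a ^ 3 * m * θ / 2 : ℝ) : ℂ) * Complex.I‖ ≤
      a ^ 2 * (|q - θ| + m ^ 2) + (|a| * K) ^ 3 := by
    refine (norm_add_le _ _).trans ?_
    rw [norm_mul, Complex.norm_I, mul_one, Complex.norm_real, Complex.norm_real, Real.norm_eq_abs,
      Real.norm_eq_abs]
    have b1 : |-(a ^ 2 * (q - θ) / 2) + a ^ 2 * m ^ 2 / 2 - a ^ 4 * θ ^ 2 / 8| ≤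
        a ^ 2 * |q - θ| / 2 + a ^ 2 * m ^ 2 / 2 + a ^ 4 * θ ^ 2 / 8 := by
      have : |a ^ 2 * (q - θ)| = a ^ 2 * |q - θ| := by rw [abs_mul, abs_of_nonneg (sq_nonneg a)]
      have c1 := le_abs_self (a ^ 2 * (q - θ))
      have c2 := neg_abs_le (a ^ 2 * (q - θ))
      have c3 : 0 ≤ a ^ 2 * m ^ 2 := by positivity
      have c4 : 0 ≤ a ^ 4 * θ ^ 2 := by positivity
      rw [abs_le]; constructor <;> linarith
    have b2 : |a ^ 3 * m * θ / 2| ≤ (|a| * K) ^ 3 / 2 := by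
      rw [abs_div, abs_mul, abs_mul, abs_pow, abs_of_nonneg hθ, abs_two]
      calc |a| ^ 3 * |m| * θ / 2 ≤ |a| ^ 3 * K * K ^ 2 / 2 := by gcongr
        _ = _ := by ring
    have b3 : a ^ 4 * θ ^ 2 ≤ (|a| * K) ^ 3 := by
      calc a ^ 4 * θ ^ 2 ≤ a ^ 4 * (K ^ 2) ^ 2 := by gcongr
        _ = (|a| * K) ^ 3 * (|a| * K) := by
          rw [show a ^ 4 = |a| ^ 4 by rw [← abs_pow, abs_of_nonneg (by positivity)]]; ring
        _ ≤ _ := mul_le_of_le_one_right (by positivity) (by linarith)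
    have c1 : 0 ≤ a ^ 2 * |q - θ| := by positivity
    have c2 : 0 ≤ a ^ 2 * m ^ 2 := by positivity
    have c3 : 0 ≤ (|a| * K) ^ 3 := by positivity
    linarith
  have hmc : (m : ℂ) = ∑ i, (p i : ℂ) * x i := by rw [hm]; push_cast; rfl
  have hqc : (q : ℂ) = ∑ i, (p i : ℂ) * x i ^ 2 := by rw [hq]; push_cast; rfl
  have hpc : ∑ i, (p i : ℂ) = 1 := by exact_mod_cast hp1
  have e1 : ∑ i, (p i : ℂ) * (1 + a * x i * Complex.I + (a * x i * Complex.I) ^ 2 / 2) =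
      1 + a * m * Complex.I - a ^ 2 * q / 2 := by
    have : ∀ i, (p i : ℂ) * (1 + a * x i * Complex.I + (a * x i * Complex.I) ^ 2 / 2) =
        p i + p i * x i * (a * Complex.I) - p i * x i ^ 2 * (a ^ 2 / 2) := fun i => by
      rw [mul_pow _ Complex.I, Complex.I_sq]
      ring
    simp_rw [this]
    rw [Finset.sum_sub_distrib, Finset.sum_add_distrib, ← Finset.sum_mul, ← Finset.sum_mul, hpc,
      ← hmc, ← hqc]
    ring
  have e2 : ∑ i, (p i : ℂ) * Complex.exp (a * x i * Complex.I) - Complex.exp z =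
      ∑ i, (p i : ℂ) * (Complex.exp (a * x i * Complex.I) -
        (1 + a * x i * Complex.I + (a * x i * Complex.I) ^ 2 / 2)) -
      (Complex.exp z - (1 + z + z ^ 2 / 2)) +
      (((-(a ^ 2 * (q - θ) / 2) + a ^ 2 * m ^ 2 / 2 - a ^ 4 * θ ^ 2 / 8 : ℝ) : ℂ)
      + ((a ^ 3 * m * θ / 2 : ℝ) : ℂ) * Complex.I) := by
    simp_rw [mul_sub, Finset.sum_sub_distrib, e1, hz]
    push_cast
    have : Complex.I ^ 2 = -1 := Complex.I_sq
    linear_combination (-a ^ 2 * m ^ 2 / 2 : ℂ) * this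
  rw [e2]
  refine (norm_add_le _ _).trans ?_
  have := norm_sub_le (∑ i, (p i : ℂ) * (Complex.exp (a * x i * Complex.I) -
        (1 + a * x i * Complex.I + (a * x i * Complex.I) ^ 2 / 2)))
      (Complex.exp z - (1 + z + z ^ 2 / 2))
  linarith

section Urn

variable {Ω ι : Type*} [Fintype ι] [DecidableEq ι] [MeasurableSpace Ω]
  {R : Matrix ι ι ℝ} {c₀ : ι → ℝ} {X : ℕ → Ω → ι}
  {μ : Measure Ω} [IsProbabilityMeasure μ]

/-- The local error in the Gaussian approximation of the increment `β v (X n)`. -/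
noncomputable def urnError (μ : Measure Ω) (R : Matrix ι ι ℝ) (c₀ : ι → ℝ) (X : ℕ → Ω → ι)
    (x : ι → ℝ) (θ : ℝ) (n : ℕ) : ℝ :=
  ∫ ω, (|∑ i, urnProp R c₀ X n ω i * x i ^ 2 - θ| + (∑ i, urnProp R c₀ X n ω i * x i) ^ 2) ∂μ

/-- A Lindeberg-type induction: each draw is replaced by a Gaussian factor of the same conditional
mean and of fixed variance θ. All remaining factors have modulus at most 1, so the local errors add
up. -/
theorem IsUrnDraws.norm_integral_cexp_sub_le (hX : IsUrnDraws μ R c₀ X)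
    (hR : R ∈ Matrix.rowStochastic ℝ ι) (hc₀ : c₀ ∈ stdSimplex ℝ ι) {v : ι → ℝ} {β K θ : ℝ}
    (hv : R *ᵥ v = β • v) (hK : ∀ i, |β * v i| ≤ K) (hθ : 0 ≤ θ) (hθK : θ ≤ K ^ 2)
    {a : ℕ → ℝ} {n : ℕ} (ha : ∀ k < n, a k = a (k + 1) * (1 + β / ((k : ℝ) + 1)))
    (haK : ∀ k < n, |a (k + 1)| * K ≤ 1 / 2) :
    ‖∫ ω, Complex.exp (a n * (urnContents R c₀ X n ω ⬝ᵥ v : ℝ) * Complex.I) ∂μ -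
      Complex.exp (a 0 * (c₀ ⬝ᵥ v : ℝ) * Complex.I) *
        Real.exp (-(θ / 2 * ∑ k ∈ Finset.range n, a (k + 1) ^ 2))‖ ≤
      ∑ k ∈ Finset.range n, (a (k + 1) ^ 2 * urnError μ R c₀ X (fun i => β * v i) θ k +
        10 * (|a (k + 1)| * K) ^ 3) := by
  induction n with
  | zero => simp [urnContents]
  | succ n ih =>
    specialize ih (fun k hk => ha k (by omega)) (fun k hk => haK k (by omega))
    have hm := hX.measurableSet_draw
    set b := a (n + 1) with hb
    set Y : Ω → ℝ := fun ω => urnContents R c₀ X n ω ⬝ᵥ v with hY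
    set g : Ω → ℂ := fun ω => Complex.exp (b * Y ω * Complex.I) with hg
    have hYm : Measurable[urnFiltration R c₀ X hm n] Y :=
      measurable_urnFiltration_dotProduct hm v n
    have hYm0 : Measurable Y := measurable_dotProduct hm v n
    have hgs : StronglyMeasurable[urnFiltration R c₀ X hm n] g :=
      Measurable.stronglyMeasurable
        ((by fun_prop : Measurable fun y : ℝ => Complex.exp (b * y * Complex.I)).comp hYm)
    have hgm : Measurable g :=
      (by fun_prop : Measurable fun y : ℝ => Complex.exp (b * y * Complex.I)).comp hYm0
    have hg1 : ∀ ω, ‖g ω‖ = 1 := fun ω => by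
      have := Complex.norm_exp_ofReal_mul_I (b * Y ω)
      push_cast at this; exact this
    have s1 : ∫ ω, Complex.exp (b * (urnContents R c₀ X (n + 1) ω ⬝ᵥ v : ℝ) * Complex.I) ∂μ =
        ∫ ω, g ω * ∑ i, (urnProp R c₀ X n ω i : ℂ) *
          Complex.exp (b * (β * v i : ℝ) * Complex.I) ∂μ := by
      refine Eq.trans ?_ (hX.integral_mul_draw (𝕜 := ℂ) hgs (fun ω => (hg1 ω).le)
        (fun i => Complex.exp (b * (β * v i : ℝ) * Complex.I)))
      refine integral_congr_ae (Eventually.of_forall fun ω => ?_)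
      simp only [hg, hY, ← Complex.exp_add, urnContents_succ_dotProduct hv]
      congr 1
      push_cast; ring
    -- The conditional mean βY/(n+1) turns the frequency b into b(1 + β/(n+1)) = a n, so the
    -- Gaussian surrogate reproduces the characteristic function at time n times a deterministic
    -- factor.
    have s2 : (Real.exp (-(θ / 2 * b ^ 2)) : ℂ) *
        ∫ ω, Complex.exp (a n * (Y ω : ℝ) * Complex.I) ∂μ =
        ∫ ω, g ω * Complex.exp (b * (∑ i, urnProp R c₀ X n ω i * (β * v i) : ℝ) * Complex.I -
          (b ^ 2 * θ / 2 : ℝ)) ∂μ := by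
      rw [← integral_const_mul]
      refine integral_congr_ae (Eventually.of_forall fun ω => ?_)
      have e : ∑ i, urnProp R c₀ X n ω i * (β * v i) = β * (Y ω / ((n : ℝ) + 1)) := by
        rw [hY]; simp only [← sum_urnProp_mul, Finset.mul_sum]
        exact Finset.sum_congr rfl fun i _ => by ring
      simp only [hg, e, Complex.ofReal_exp, ← Complex.exp_add, ha n (by omega), ← hb]
      congr 1
      push_cast; ring
    have hpm : ∀ i, Measurable fun ω => (urnProp R c₀ X n ω i : ℂ) := fun i =>
      Complex.measurable_ofReal.comp (measurable_urnProp hm n i)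
    have hmm : Measurable fun ω => ∑ i, urnProp R c₀ X n ω i * (β * v i) :=
      measurable_sum_urnProp_mul hm _ n
    set A : Ω → ℂ := fun ω => ∑ i, (urnProp R c₀ X n ω i : ℂ) *
          Complex.exp (b * (β * v i : ℝ) * Complex.I) with hA
    set G : Ω → ℂ := fun ω => Complex.exp (b * (∑ i, urnProp R c₀ X n ω i * (β * v i) : ℝ) *
      Complex.I - (b ^ 2 * θ / 2 : ℝ)) with hG
    have hAm : Measurable A := Finset.measurable_fun_sum _ fun i _ => (hpm i).mul_const _
    have hGm : Measurable G := by
      have := Complex.measurable_ofReal.comp hmm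
      exact Complex.measurable_exp.comp (((this.const_mul _).mul_const _).sub_const _)
    have hAb : ∀ ω, ‖A ω‖ ≤ 1 := fun ω => by
      refine (norm_sum_le _ _).trans (le_of_eq ?_)
      rw [← sum_urnProp hR hc₀ (X := X) n ω]
      refine Finset.sum_congr rfl fun i _ => ?_
      have := Complex.norm_exp_ofReal_mul_I (b * (β * v i))
      push_cast at this
      rw [norm_mul, Complex.norm_real, Real.norm_of_nonneg (urnProp_nonneg hR hc₀ n ω i)]
      push_cast
      rw [this, mul_one]
    have hGb : ∀ ω, ‖G ω‖ ≤ 1 := fun ω => by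
      simp only [hG, Complex.norm_exp]
      rw [Real.exp_le_one_iff, Complex.sub_re, Complex.ofReal_re, ← Complex.ofReal_mul,
        Complex.re_ofReal_mul, Complex.I_re]
      have : 0 ≤ b ^ 2 * θ / 2 := by positivity
      linarith
    have hAi : Integrable (fun ω => g ω * A ω) μ :=
      Integrable.of_bound (hgm.mul hAm).aestronglyMeasurable 1 (Eventually.of_forall fun ω => by
        rw [norm_mul, hg1, one_mul]; exact hAb ω)
    have hGi : Integrable (fun ω => g ω * G ω) μ :=
      Integrable.of_bound (hgm.mul hGm).aestronglyMeasurable 1 (Eventually.of_forall fun ω => by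
        rw [norm_mul, hg1, one_mul]; exact hGb ω)
    have hstep : ‖∫ ω, g ω * A ω ∂μ - ∫ ω, g ω * G ω ∂μ‖ ≤
        b ^ 2 * urnError μ R c₀ X (fun i => β * v i) θ n + 10 * (|b| * K) ^ 3 := by
      rw [← integral_sub hAi hGi]
      have hEi : Integrable (fun ω => |∑ i, urnProp R c₀ X n ω i * (β * v i) ^ 2 - θ| +
          (∑ i, urnProp R c₀ X n ω i * (β * v i)) ^ 2) μ := by
        refine Integrable.add ((integrable_sum_urnProp_mul hR hc₀ hm (fun i => (β * v i) ^ 2) n).sub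
          (integrable_const _)).abs ?_
        refine Integrable.of_bound (hmm.pow_const 2).aestronglyMeasurable (K ^ 2)
          (Eventually.of_forall fun ω => ?_)
        rw [norm_pow]
        exact pow_le_pow_left₀ (norm_nonneg _) (abs_sum_urnProp_mul_le hR hc₀ hK n ω) 2
      calc _ ≤ ∫ ω, (b ^ 2 * (|∑ i, urnProp R c₀ X n ω i * (β * v i) ^ 2 - θ| +
          (∑ i, urnProp R c₀ X n ω i * (β * v i)) ^ 2) + 10 * (|b| * K) ^ 3) ∂μ := by
            refine norm_integral_le_of_norm_le ((hEi.const_mul _).add (integrable_const _))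
              (Eventually.of_forall fun ω => ?_)
            rw [← mul_sub, norm_mul, hg1, one_mul]
            exact norm_sum_mul_cexp_sub_le (urnProp_nonneg hR hc₀ n ω) (sum_urnProp hR hc₀ n ω)
              hK hθ hθK (haK n (by omega))
        _ = _ := by
          rw [integral_add (hEi.const_mul _) (integrable_const _), integral_const_mul, urnError]
          simp
    have hexp : ‖(Real.exp (-(θ / 2 * b ^ 2)) : ℂ)‖ ≤ 1 := by
      rw [Complex.norm_real, Real.norm_of_nonneg (Real.exp_pos _).le, Real.exp_le_one_iff]
      have : 0 ≤ θ / 2 * b ^ 2 := by positivity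
      linarith
    rw [Finset.sum_range_succ, Finset.sum_range_succ, mul_add, neg_add, Real.exp_add, s1,
      Complex.ofReal_mul]
    set W : ℂ := Complex.exp (a 0 * (c₀ ⬝ᵥ v : ℝ) * Complex.I) *
        Real.exp (-(θ / 2 * ∑ k ∈ Finset.range n, a (k + 1) ^ 2)) with hW
    have hsplit : ∫ ω, g ω * A ω ∂μ - Complex.exp (a 0 * (c₀ ⬝ᵥ v : ℝ) * Complex.I) *
        (Real.exp (-(θ / 2 * ∑ k ∈ Finset.range n, a (k + 1) ^ 2)) *
          Real.exp (-(θ / 2 * b ^ 2))) =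
        (Real.exp (-(θ / 2 * b ^ 2)) : ℂ) *
          (∫ ω, Complex.exp (a n * (Y ω : ℝ) * Complex.I) ∂μ - W) +
        (∫ ω, g ω * A ω ∂μ - ∫ ω, g ω * G ω ∂μ) := by
      rw [mul_sub, s2, hW]; ring
    rw [hsplit]
    refine (norm_add_le _ _).trans (add_le_add ?_ hstep)
    rw [norm_mul]
    exact (mul_le_of_le_one_left (norm_nonneg _) hexp).trans ih

/-- The hypothesis `hsum` serves twice: with g = 1 it gives the limiting variance, with g the local
error it shows that the accumulated error vanishes. The cubic terms are the largest frequency times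
a bounded sum of squares. -/
theorem IsUrnDraws.tendsto_integral_cexp (hX : IsUrnDraws μ R c₀ X)
    (hR : R ∈ Matrix.rowStochastic ℝ ι) (hc₀ : c₀ ∈ stdSimplex ℝ ι) {v : ι → ℝ} {β K θ c : ℝ}
    (hv : R *ᵥ v = β • v) (hK : ∀ i, |β * v i| ≤ K) (hθ : 0 ≤ θ) (hθK : θ ≤ K ^ 2)
    (herr : Tendsto (urnError μ R c₀ X (fun i => β * v i) θ) atTop (𝓝 0))
    {r b : ℕ → ℝ} (hb : Tendsto b atTop (𝓝 0))
    (hrb : ∀ᶠ n in atTop, ∀ k, |urnProdIco β k n / r n| ≤ b n)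
    (hsum : ∀ (g : ℕ → ℝ) (g₀ : ℝ), Tendsto g atTop (𝓝 g₀) →
      Tendsto (fun n => (∑ k ∈ Finset.range n, urnProdIco β (k + 1) n ^ 2 * g k) / r n ^ 2) atTop
        (𝓝 (c * g₀))) (t : ℝ) :
    Tendsto (fun n => ∫ ω, Complex.exp (t * ((urnContents R c₀ X n ω ⬝ᵥ v) / r n : ℝ) *
      Complex.I) ∂μ) atTop (𝓝 (Real.exp (-(c * θ * t ^ 2 / 2)))) := by
  set a : ℕ → ℕ → ℝ := fun n k => t * (urnProdIco β k n / r n) with ha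
  have hsq : ∀ (g : ℕ → ℝ) (g₀ : ℝ), Tendsto g atTop (𝓝 g₀) →
      Tendsto (fun n => ∑ k ∈ Finset.range n, a n (k + 1) ^ 2 * g k) atTop
        (𝓝 (t ^ 2 * (c * g₀))) := by
    intro g g₀ hg
    refine ((hsum g g₀ hg).const_mul (t ^ 2)).congr fun n => ?_
    rw [Finset.sum_div, Finset.mul_sum]
    exact Finset.sum_congr rfl fun k _ => by simp only [ha]; ring
  have hab : ∀ᶠ n in atTop, ∀ k, |a n k| ≤ |t| * b n := by
    filter_upwards [hrb] with n hn k
    rw [ha, abs_mul]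
    gcongr
    exact hn k
  have htb : Tendsto (fun n => |t| * b n) atTop (𝓝 0) := by simpa using hb.const_mul |t|
  have hone := hsq (fun _ => 1) 1 tendsto_const_nhds
  simp only [mul_one] at hone
  have h0 : Tendsto (fun n => Complex.exp (a n 0 * (c₀ ⬝ᵥ v : ℝ) * Complex.I) *
        (Real.exp (-(θ / 2 * ∑ k ∈ Finset.range n, a n (k + 1) ^ 2)) : ℂ)) atTop
      (𝓝 (Real.exp (-(c * θ * t ^ 2 / 2)))) := by
    have ha0 : Tendsto (fun n => a n 0) atTop (𝓝 0) :=
      squeeze_zero_norm' (hab.mono fun n hn => hn 0) htb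
    have l1 : Tendsto (fun n => Complex.exp (a n 0 * (c₀ ⬝ᵥ v : ℝ) * Complex.I)) atTop (𝓝 1) := by
      have hc : Continuous fun x : ℝ => Complex.exp (x * (c₀ ⬝ᵥ v : ℝ) * Complex.I) := by fun_prop
      have := (hc.tendsto 0).comp ha0
      simp only [Function.comp_def] at this
      simpa using this
    have l2 := (Complex.continuous_ofReal.tendsto _).comp
      ((Real.continuous_exp.tendsto _).comp (hone.const_mul (θ / 2)).neg)
    have := l1.mul l2
    rw [one_mul] at this
    rw [show -(c * θ * t ^ 2 / 2) = -(θ / 2 * (t ^ 2 * c)) by ring]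
    exact this
  have hbound : Tendsto (fun n => ∑ k ∈ Finset.range n, a n (k + 1) ^ 2 *
      urnError μ R c₀ X (fun i => β * v i) θ k +
      10 * K ^ 3 * (|t| * b n) * ∑ k ∈ Finset.range n, a n (k + 1) ^ 2) atTop (𝓝 0) := by
    have := (hsq _ 0 herr).add ((htb.const_mul (10 * K ^ 3)).mul hone)
    simpa using this
  have hdiff : Tendsto (fun n => ∫ ω, Complex.exp (t * ((urnContents R c₀ X n ω ⬝ᵥ v) / r n : ℝ) *
      Complex.I) ∂μ - Complex.exp (a n 0 * (c₀ ⬝ᵥ v : ℝ) * Complex.I) *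
        (Real.exp (-(θ / 2 * ∑ k ∈ Finset.range n, a n (k + 1) ^ 2)) : ℂ)) atTop (𝓝 0) := by
    have hsmall : ∀ᶠ n in atTop, |t| * b n * K < 1 / 2 := by
      have : Tendsto (fun n => |t| * b n * K) atTop (𝓝 0) := by simpa using htb.mul_const K
      exact (tendsto_order.1 this).2 _ (by norm_num)
    refine squeeze_zero_norm' ?_ hbound
    filter_upwards [hab, hsmall] with n hn hsm
    obtain ⟨ω₀⟩ := nonempty_of_isProbabilityMeasure μ
    have hK0 : 0 ≤ K := (abs_nonneg _).trans (hK (X 0 ω₀))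
    have h := hX.norm_integral_cexp_sub_le hR hc₀ hv hK hθ hθK (a := a n) (n := n)
      (fun k hk => by
        simp only [ha, urnProdIco_eq_mul β hk]; ring)
      (fun k _ => (mul_le_mul_of_nonneg_right (hn _) hK0).trans hsm.le)
    have e : ∀ ω, (a n n * (urnContents R c₀ X n ω ⬝ᵥ v : ℝ) * Complex.I : ℂ) =
        t * ((urnContents R c₀ X n ω ⬝ᵥ v) / r n : ℝ) * Complex.I := by
      intro ω
      simp only [ha, urnProdIco_self]
      push_cast; ring
    simp_rw [e] at h
    refine h.trans ?_
    rw [Finset.sum_add_distrib, Finset.mul_sum]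
    refine add_le_add le_rfl (Finset.sum_le_sum fun k _ => ?_)
    calc 10 * (|a n (k + 1)| * K) ^ 3 = 10 * K ^ 3 * |a n (k + 1)| * a n (k + 1) ^ 2 := by
          rw [← sq_abs (a n (k + 1))]; ring
      _ ≤ _ := by gcongr; exact hn _
  simpa using hdiff.add h0

/-- Gaussian limit of the coordinate of the urn contents along a right eigenvector. -/
theorem IsUrnDraws.tendstoInDistribution (hX : IsUrnDraws μ R c₀ X)
    (hR : R ∈ Matrix.rowStochastic ℝ ι) (hc₀ : c₀ ∈ stdSimplex ℝ ι) {v : ι → ℝ} {β K θ c : ℝ}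
    (hv : R *ᵥ v = β • v) (hK : ∀ i, |β * v i| ≤ K) (hθ : 0 ≤ θ) (hθK : θ ≤ K ^ 2)
    (herr : Tendsto (urnError μ R c₀ X (fun i => β * v i) θ) atTop (𝓝 0))
    {r b : ℕ → ℝ} (hb : Tendsto b atTop (𝓝 0))
    (hrb : ∀ᶠ n in atTop, ∀ k, |urnProdIco β k n / r n| ≤ b n)
    (hsum : ∀ (g : ℕ → ℝ) (g₀ : ℝ), Tendsto g atTop (𝓝 g₀) →
      Tendsto (fun n => (∑ k ∈ Finset.range n, urnProdIco β (k + 1) n ^ 2 * g k) / r n ^ 2) atTop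
        (𝓝 (c * g₀))) (hc : 0 ≤ c) :
    TendstoInDistribution (fun n ω => (urnContents R c₀ X n ω ⬝ᵥ v) / r n) atTop
      (fun x : ℝ => x) (fun _ => μ) (gaussianReal 0 (Real.toNNReal (c * θ))) where
  forall_aemeasurable n :=
    ((measurable_dotProduct hX.measurableSet_draw v n).div_const _).aemeasurable
  tendsto := by
    refine ProbabilityMeasure.tendsto_iff_tendsto_charFun.2 fun t => ?_
    have h := hX.tendsto_integral_cexp hR hc₀ hv hK hθ hθK herr hb hrb hsum t
    have e1 : charFun ((gaussianReal 0 (Real.toNNReal (c * θ))).map (fun x : ℝ => x)) t =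
        Real.exp (-(c * θ * t ^ 2 / 2)) := by
      rw [Measure.map_id', charFun_gaussianReal, Real.coe_toNNReal _ (mul_nonneg hc hθ)]
      push_cast
      congr 1
      ring
    have e2 : ∀ n, charFun (μ.map fun ω => (urnContents R c₀ X n ω ⬝ᵥ v) / r n) t =
        ∫ ω, Complex.exp (t * ((urnContents R c₀ X n ω ⬝ᵥ v) / r n : ℝ) * Complex.I) ∂μ := by
      intro n
      rw [charFun_apply_real, integral_map
        ((measurable_dotProduct hX.measurableSet_draw v n).div_const _).aemeasurable]
      exact Continuous.aestronglyMeasurable (by fun_prop)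
    simp only [ProbabilityMeasure.coe_mk, e1, e2]
    exact h

end Urn

/-! ### The supercritical martingale -/

theorem uniformIntegrable_one_of_eLpNorm_two_le {Ω κ : Type*} [MeasurableSpace Ω] {μ : Measure Ω}
    [IsFiniteMeasure μ] {f : κ → Ω → ℝ} (hf : ∀ i, AEStronglyMeasurable (f i) μ) {K : ℝ≥0}
    (hK : ∀ i, eLpNorm (f i) 2 μ ≤ K) : UniformIntegrable f 1 μ := by
  refine uniformIntegrable_of le_rfl ENNReal.one_ne_top hf fun ε hε => ?_
  set e : ℝ≥0 := ε.toNNReal with he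
  have he0 : 0 < e := Real.toNNReal_pos.2 hε
  -- Where |f| ≥ C one has |f| ≤ f²/C, so the tail integral is at most K²/C ≤ ε. The added 1 keeps C
  -- positive when K = 0.
  set C : ℝ≥0 := (K ^ 2 + 1) / e with hC
  have hC0 : 0 < C := by positivity
  refine ⟨C, fun i => ?_⟩
  have h2 : ∫⁻ ω, ‖f i ω‖ₑ ^ 2 ∂μ ≤ (K : ℝ≥0∞) ^ 2 := by
    have := eLpNorm_nnreal_pow_eq_lintegral (f := f i) (μ := μ) (p := 2) two_ne_zero
    have h3 : eLpNorm (f i) ((2 : ℝ≥0) : ℝ≥0∞) μ ^ ((2 : ℝ≥0) : ℝ) = eLpNorm (f i) 2 μ ^ 2 := by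
      simp
    rw [h3] at this
    have h4 : ∫⁻ ω, ‖f i ω‖ₑ ^ ((2 : ℝ≥0) : ℝ) ∂μ = ∫⁻ ω, ‖f i ω‖ₑ ^ 2 ∂μ := by simp
    rw [← h4, ← this]
    gcongr
    exact hK i
  have hCi : ((C : ℝ≥0∞))⁻¹ * (K : ℝ≥0∞) ^ 2 ≤ ENNReal.ofReal ε := by
    rw [ENNReal.ofReal, ← he, ← ENNReal.coe_inv hC0.ne']
    norm_cast
    rw [hC, inv_div, div_mul_eq_mul_div, div_le_iff₀ (by positivity)]
    gcongr
    exact le_self_add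
  refine le_trans ?_ hCi
  rw [eLpNorm_one_eq_lintegral_enorm]
  calc ∫⁻ ω, ‖({ω | C ≤ ‖f i ω‖₊}.indicator (f i)) ω‖ₑ ∂μ
      ≤ ∫⁻ ω, (C : ℝ≥0∞)⁻¹ * ‖f i ω‖ₑ ^ 2 ∂μ := by
        refine lintegral_mono fun ω => ?_
        by_cases h : C ≤ ‖f i ω‖₊
        · rw [Set.indicator_of_mem (show ω ∈ {ω | C ≤ ‖f i ω‖₊} from h), enorm_eq_nnnorm,
            ← ENNReal.coe_inv hC0.ne']
          norm_cast
          refine ENNReal.coe_le_coe.2 ?_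
          rw [inv_mul_eq_div, le_div_iff₀ hC0, sq]
          gcongr
        · rw [Set.indicator_of_notMem (show ω ∉ {ω | C ≤ ‖f i ω‖₊} from h)]
          simp
    _ = (C : ℝ≥0∞)⁻¹ * ∫⁻ ω, ‖f i ω‖ₑ ^ 2 ∂μ :=
        lintegral_const_mul' _ _ (by simp [hC0.ne'])
    _ ≤ _ := by gcongr

theorem eLpNorm_two_le_of_integral_sq_le {Ω : Type*} [MeasurableSpace Ω] {μ : Measure Ω}
    {f : Ω → ℝ} (hf : MemLp f 2 μ) {B : ℝ} (hB : ∫ ω, f ω ^ 2 ∂μ ≤ B) :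
    eLpNorm f 2 μ ≤ (Real.sqrt B).toNNReal := by
  rw [hf.eLpNorm_eq_integral_rpow_norm two_ne_zero ENNReal.ofNat_ne_top]
  refine ENNReal.ofReal_le_ofReal ?_
  have e : ∫ ω, ‖f ω‖ ^ (2 : ℝ≥0∞).toReal ∂μ = ∫ ω, f ω ^ 2 ∂μ := by simp
  rw [e, Real.sqrt_eq_rpow, ENNReal.toReal_ofNat, one_div]
  have : 0 ≤ ∫ ω, f ω ^ 2 ∂μ := integral_nonneg fun ω => sq_nonneg _
  gcongr

/-- The terms are O(n^(-2β)), and 2β > 1. -/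
theorem summable_inv_urnProd_sq {β : ℝ} (hβ : 1 / 2 < β) :
    Summable fun n : ℕ => (urnProd (n + 1) β ^ 2)⁻¹ := by
  rw [summable_nat_add_iff 1 (f := fun n : ℕ => (urnProd n β ^ 2)⁻¹)]
  have hβ0 : 0 < β := by linarith
  have hG : 0 < β * Real.Gamma β := mul_pos hβ0 (Real.Gamma_pos_of_pos hβ0)
  have h := (((tendsto_urnProd_div_rpow hβ0).pow 2).inv₀ (by positivity)).isBigO_one ℝ
  have hs : Summable fun n : ℕ => (n : ℝ) ^ (-(2 * β)) :=
    Real.summable_nat_rpow.2 (by linarith)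
  refine summable_of_isBigO_nat hs ?_
  have h2 := h.mul (Asymptotics.isBigO_refl (fun n : ℕ => (n : ℝ) ^ (-(2 * β))) atTop)
  simp only [one_mul] at h2
  refine h2.congr' ?_ EventuallyEq.rfl
  filter_upwards [eventually_ge_atTop 1] with n hn
  have hn0 : (0 : ℝ) < n := by exact_mod_cast hn
  have hu := urnProd_pos hβ0 n
  have : (n : ℝ) ^ (-(2 * β)) = (((n : ℝ) ^ β) ^ 2)⁻¹ := by
    rw [Real.rpow_neg hn0.le, mul_comm, Real.rpow_mul hn0.le]; norm_num
  rw [this]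
  have : (0 : ℝ) < (n : ℝ) ^ β := by positivity
  field_simp

theorem tendsto_urnProd_div_succ {β : ℝ} (hβ0 : 0 < β) (hβ1 : β < 1) :
    Tendsto (fun n : ℕ => urnProd n β / ((n : ℝ) + 1)) atTop (𝓝 0) := by
  have h1 : Tendsto (fun n : ℕ => (n : ℝ) ^ (-(1 - β))) atTop (𝓝 0) :=
    (tendsto_rpow_neg_atTop (by linarith)).comp tendsto_natCast_atTop_atTop
  have h2 := (tendsto_urnProd_div_rpow hβ0).mul h1
  rw [mul_zero] at h2
  refine squeeze_zero' (Eventually.of_forall fun n => ?_) ?_ h2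
  · have := urnProd_pos hβ0 n
    positivity
  · filter_upwards [eventually_ge_atTop 1] with n hn
    have hn0 : (0 : ℝ) < n := by exact_mod_cast hn
    have hu := urnProd_pos hβ0 n
    have hp : (0 : ℝ) < (n : ℝ) ^ β := by positivity
    rw [show -(1 - β) = β - 1 by ring, Real.rpow_sub hn0, Real.rpow_one]
    calc urnProd n β / ((n : ℝ) + 1) ≤ urnProd n β / n := by gcongr; linarith
      _ = _ := by field_simp

section Urn

variable {Ω ι : Type*} [Fintype ι] [DecidableEq ι] [MeasurableSpace Ω]
  {R : Matrix ι ι ℝ} {c₀ : ι → ℝ} {X : ℕ → Ω → ι}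
  {μ : Measure Ω} [IsProbabilityMeasure μ]

theorem IsUrnDraws.martingale (hX : IsUrnDraws μ R c₀ X)
    (hR : R ∈ Matrix.rowStochastic ℝ ι) (hc₀ : c₀ ∈ stdSimplex ℝ ι) {v : ι → ℝ} {β : ℝ}
    (hv : R *ᵥ v = β • v) (hβ : 0 < β) :
    Martingale (fun (n : ℕ) ω => (urnContents R c₀ X n ω ⬝ᵥ v) / urnProd n β)
      (urnFiltration R c₀ X hX.measurableSet_draw) μ := by
  have hm := hX.measurableSet_draw
  refine martingale_nat
    (fun n => ((measurable_urnFiltration_dotProduct hm v n).div_const _).stronglyMeasurable)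
    (fun n => (integrable_dotProduct hR hc₀ hm v n).div_const _) fun n => ?_
  set ℱ := urnFiltration R c₀ X hm
  have hY : Integrable (fun ω => (urnProd (n + 1) β)⁻¹ * (urnContents R c₀ X n ω ⬝ᵥ v)) μ :=
    (integrable_dotProduct hR hc₀ hm v n).const_mul _
  have hF := integrable_comp_draw (μ := μ) hm (fun i => (urnProd (n + 1) β)⁻¹ * (β * v i)) n
  have e1 : (fun ω => (urnContents R c₀ X (n + 1) ω ⬝ᵥ v) / urnProd (n + 1) β) =
      (fun ω => (urnProd (n + 1) β)⁻¹ * (urnContents R c₀ X n ω ⬝ᵥ v)) +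
        fun ω => (urnProd (n + 1) β)⁻¹ * (β * v (X n ω)) := by
    ext ω
    simp only [Pi.add_apply, urnContents_succ_dotProduct hv]
    ring
  have h1 : μ[fun ω => (urnProd (n + 1) β)⁻¹ * (urnContents R c₀ X n ω ⬝ᵥ v) | ℱ n] =
      fun ω => (urnProd (n + 1) β)⁻¹ * (urnContents R c₀ X n ω ⬝ᵥ v) :=
    condExp_of_stronglyMeasurable (ℱ.le n)
      ((measurable_urnFiltration_dotProduct hm v n).const_mul _).stronglyMeasurable hY
  have h2 := hX.condExp_draw n (fun i => (urnProd (n + 1) β)⁻¹ * (β * v i))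
  have h3 := condExp_add hY hF (ℱ n)
  rw [e1]
  filter_upwards [h2, h3] with ω h2 h3
  rw [h3, Pi.add_apply, h1, h2]
  have e2 : urnContents R c₀ X n ω ⬝ᵥ (fun i => (urnProd (n + 1) β)⁻¹ * (β * v i)) =
      (urnProd (n + 1) β)⁻¹ * (β * (urnContents R c₀ X n ω ⬝ᵥ v)) := by
    simp only [dotProduct, Finset.mul_sum]
    exact Finset.sum_congr rfl fun i _ => by ring
  rw [e2, urnProd_succ]
  have hu := (urnProd_pos hβ n).ne'
  have : (n : ℝ) + 1 + β ≠ 0 := by positivity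
  field_simp

/-- Divide the second-moment recursion by Π_{n+1}(β)². Since 1 + 2x ≤ (1 + x)², the normalised
moment grows by at most β²‖v‖²/Π_{n+1}(β)², which is summable. -/
theorem IsUrnDraws.exists_eLpNorm_two_le (hX : IsUrnDraws μ R c₀ X)
    (hR : R ∈ Matrix.rowStochastic ℝ ι) (hc₀ : c₀ ∈ stdSimplex ℝ ι) {v : ι → ℝ} {β : ℝ}
    (hv : R *ᵥ v = β • v) (hβ : 1 / 2 < β) :
    ∃ K : ℝ≥0, ∀ n : ℕ,
      eLpNorm (fun ω => (urnContents R c₀ X n ω ⬝ᵥ v) / urnProd n β) 2 μ ≤ K := by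
  have hm := hX.measurableSet_draw
  have hβ0 : 0 < β := by linarith
  set z : ℕ → ℝ := fun n => (∫ ω, (urnContents R c₀ X n ω ⬝ᵥ v) ^ 2 ∂μ) / urnProd n β ^ 2 with hz
  set A := β ^ 2 * ‖v‖ ^ 2 with hA
  have hstep : ∀ n, z (n + 1) ≤ z n + A * (urnProd (n + 1) β ^ 2)⁻¹ := by
    intro n
    have hB := integral_comp_draw_sq_le (μ := μ) (X := X) (fun i => norm_le_pi_norm v i) n
    have hy : 0 ≤ ∫ ω, (urnContents R c₀ X n ω ⬝ᵥ v) ^ 2 ∂μ := integral_nonneg fun ω => sq_nonneg _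
    simp only [hz]
    rw [hX.integral_dotProduct_sq_succ hR hc₀ hv]
    set y := ∫ ω, (urnContents R c₀ X n ω ⬝ᵥ v) ^ 2 ∂μ
    have hu := urnProd_pos hβ0 n
    have hu1 := urnProd_pos hβ0 (n + 1)
    have h1 : 1 + 2 * β / ((n : ℝ) + 1) ≤ (1 + β / ((n : ℝ) + 1)) ^ 2 := by
      have := sq_nonneg (β / ((n : ℝ) + 1))
      rw [mul_div_assoc]; nlinarith
    have hpos : 0 < 1 + β / ((n : ℝ) + 1) := by positivity
    calc ((1 + 2 * β / ((n : ℝ) + 1)) * y + β ^ 2 * ∫ ω, v (X n ω) ^ 2 ∂μ) / urnProd (n + 1) β ^ 2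
        ≤ ((1 + β / ((n : ℝ) + 1)) ^ 2 * y + β ^ 2 * ‖v‖ ^ 2) / urnProd (n + 1) β ^ 2 := by
          gcongr
      _ = (1 + β / ((n : ℝ) + 1)) ^ 2 * y / urnProd (n + 1) β ^ 2 +
          A * (urnProd (n + 1) β ^ 2)⁻¹ := by rw [add_div, hA, div_eq_mul_inv (β ^ 2 * ‖v‖ ^ 2)]
      _ = _ := by
          congr 1
          rw [urnProd_succ, mul_pow, mul_comm, mul_div_mul_right _ _ (by positivity)]
  have hs := summable_inv_urnProd_sq hβ
  have hbound : ∀ n, z n ≤ z 0 + A * ∑ k ∈ Finset.range n, (urnProd (k + 1) β ^ 2)⁻¹ := by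
    intro n
    induction n with
    | zero => simp
    | succ n ih =>
      rw [Finset.sum_range_succ, mul_add]
      linarith [hstep n]
  refine ⟨(Real.sqrt (z 0 + A * ∑' k, (urnProd (k + 1) β ^ 2)⁻¹)).toNNReal, fun n => ?_⟩
  refine eLpNorm_two_le_of_integral_sq_le ?_ ?_
  · refine MemLp.of_bound ((measurable_dotProduct hm v n).div_const _).aestronglyMeasurable
      (((n : ℝ) + 1) * ‖v‖ / urnProd n β) (Eventually.of_forall fun ω => ?_)
    rw [norm_div, Real.norm_of_nonneg (urnProd_pos hβ0 n).le]
    have := urnProd_pos hβ0 n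
    gcongr
    exact abs_urnContents_dotProduct_le hR hc₀ (fun i => norm_le_pi_norm v i) n ω
  · simp_rw [div_pow]
    rw [integral_div]
    refine (hbound n).trans ?_
    gcongr
    exact hs.sum_le_tsum _ fun k _ => by positivity

/-- Almost sure convergence, in the supercritical case, to a nondegenerate limit. -/
theorem IsUrnDraws.exists_ae_tendsto (hX : IsUrnDraws μ R c₀ X)
    (hR : R ∈ Matrix.rowStochastic ℝ ι) (hc₀ : c₀ ∈ stdSimplex ℝ ι) {v : ι → ℝ} {β θ : ℝ}
    (hv : R *ᵥ v = β • v) (hβ : 1 / 2 < β) (hβ1 : β < 1) (hθ : 0 < θ)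
    (hlim : Tendsto (fun n => ∫ ω, v (X n ω) ^ 2 ∂μ) atTop (𝓝 θ)) :
    ∃ Z : Ω → ℝ, Measurable Z ∧
      (∀ᵐ ω ∂μ, Tendsto (fun n : ℕ => (urnContents R c₀ X n ω ⬝ᵥ v) / (n : ℝ) ^ β) atTop
        (𝓝 (Z ω))) ∧ ¬ ∃ c : ℝ, Z =ᵐ[μ] fun _ => c := by
  have hm := hX.measurableSet_draw
  have hβ0 : 0 < β := by linarith
  have hG : 0 < β * Real.Gamma β := mul_pos hβ0 (Real.Gamma_pos_of_pos hβ0)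
  have hM := hX.martingale hR hc₀ hv hβ0
  obtain ⟨K, hK⟩ := hX.exists_eLpNorm_two_le hR hc₀ hv hβ
  set ℱ := urnFiltration R c₀ X hm
  set M : ℕ → Ω → ℝ := fun n ω => (urnContents R c₀ X n ω ⬝ᵥ v) / urnProd n β with hMdef
  have hMm : ∀ n, AEStronglyMeasurable (M n) μ := fun n =>
    ((measurable_dotProduct hm v n).div_const _).aestronglyMeasurable
  have hK1 : ∀ n, eLpNorm (M n) 1 μ ≤ K := fun n =>
    (eLpNorm_le_eLpNorm_of_exponent_le (by norm_num) (hMm n)).trans (hK n)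
  have hconv := hM.submartingale.ae_tendsto_limitProcess hK1
  have hUI := uniformIntegrable_one_of_eLpNorm_two_le hMm hK
  set L := Filtration.limitProcess M ℱ μ with hL
  have hLm : Measurable L := Filtration.stronglyMeasurable_limit_process'.measurable
  refine ⟨fun ω => L ω * (β * Real.Gamma β)⁻¹, hLm.mul_const _, ?_, ?_⟩
  · filter_upwards [hconv] with ω hω
    refine (hω.mul (tendsto_urnProd_div_rpow hβ0)).congr fun n => ?_
    rw [hMdef, div_mul_div_cancel₀ (urnProd_pos hβ0 n).ne']
  · rintro ⟨c, hc⟩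
    set d := c * (β * Real.Gamma β) with hd
    have hLd : L =ᵐ[μ] fun _ => d := by
      filter_upwards [hc] with ω hω
      rw [hd, ← hω, inv_mul_cancel_right₀ hG.ne']
    -- Uniform integrability closes the martingale: M n is the conditional expectation of its limit.
    have hMd : ∀ n, ∀ᵐ ω ∂μ, M n ω = d := fun n => by
      have h1 := hM.ae_eq_condExp_limitProcess hUI n
      have h2 := condExp_congr_ae (m := ℱ n) hLd
      rw [condExp_const (ℱ.le n)] at h2
      exact h1.trans h2
    -- Two consecutive constant values of the martingale determine the increment β v (X n) almost
    -- surely.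
    have hv2 : ∀ n, ∫ ω, v (X n ω) ^ 2 ∂μ = (d * (urnProd n β / ((n : ℝ) + 1))) ^ 2 := fun n => by
      have : ∀ᵐ ω ∂μ, v (X n ω) ^ 2 = (d * (urnProd n β / ((n : ℝ) + 1))) ^ 2 := by
        filter_upwards [hMd n, hMd (n + 1)] with ω h1 h2
        rw [hMdef, div_eq_iff (urnProd_pos hβ0 _).ne'] at h1 h2
        rw [urnContents_succ_dotProduct hv, h1, urnProd_succ] at h2
        have : β * v (X n ω) = β * (d * (urnProd n β / ((n : ℝ) + 1))) := by
          linear_combination h2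
        rw [mul_left_cancel₀ hβ0.ne' this]
      rw [integral_congr_ae this]
      simp
    have h0 : Tendsto (fun n => ∫ ω, v (X n ω) ^ 2 ∂μ) atTop (𝓝 0) := by
      simp_rw [hv2]
      simpa using ((tendsto_urnProd_div_succ hβ0 hβ1).const_mul d).pow 2
    exact hθ.ne (tendsto_nhds_unique h0 hlim)

end Urn

/-! ### Vanishing local error and normalisation of the weights -/

section Urn

variable {Ω ι : Type*} [Fintype ι] [DecidableEq ι] [MeasurableSpace Ω]
  {R : Matrix ι ι ℝ} {c₀ : ι → ℝ} {X : ℕ → Ω → ι}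
  {μ : Measure Ω} [IsProbabilityMeasure μ]

/-- The squared conditional mean is β²(C_n v)²/(n+1)², which vanishes in L¹ by the second-moment
estimate. -/
theorem IsUrnDraws.tendsto_urnError (hX : IsUrnDraws μ R c₀ X)
    (hR : R ∈ Matrix.rowStochastic ℝ ι) (hc₀ : c₀ ∈ stdSimplex ℝ ι) {v : ι → ℝ} {β θ : ℝ}
    (hv : R *ᵥ v = β • v) (hβ1 : -1 ≤ β) (hβ : β < 1)
    (h : Tendsto (fun n : ℕ => ∫ ω, |∑ i, urnProp R c₀ X n ω i * (β * v i) ^ 2 - θ| ∂μ) atTop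
      (𝓝 0)) :
    Tendsto (urnError μ R c₀ X (fun i => β * v i) θ) atTop (𝓝 0) := by
  have hm := hX.measurableSet_draw
  have h2 := h.add ((hX.tendsto_integral_dotProduct_sq_div hR hc₀ hv hβ1 hβ).const_mul (β ^ 2))
  rw [mul_zero, add_zero] at h2
  refine h2.congr fun n => ?_
  have e : ∀ ω, (∑ i, urnProp R c₀ X n ω i * (β * v i)) ^ 2 =
      β ^ 2 / ((n : ℝ) + 1) ^ 2 * (urnContents R c₀ X n ω ⬝ᵥ v) ^ 2 := fun ω => by
    have : ∑ i, urnProp R c₀ X n ω i * (β * v i) = β * ∑ i, urnProp R c₀ X n ω i * v i := by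
      rw [Finset.mul_sum]
      exact Finset.sum_congr rfl fun i _ => by ring
    rw [this, sum_urnProp_mul]
    field_simp
  simp only [urnError, e]
  have i1 : Integrable (fun ω => |∑ i, urnProp R c₀ X n ω i * (β * v i) ^ 2 - θ|) μ :=
    ((integrable_sum_urnProp_mul hR hc₀ hm (fun i => (β * v i) ^ 2) n).sub
      (integrable_const θ)).abs
  rw [integral_add i1 ((integrable_dotProduct_sq hR hc₀ hm v n).const_mul _), integral_const_mul]
  ring

theorem IsUrnDraws.tendsto_integral_draw (hX : IsUrnDraws μ R c₀ X)
    (hR : R ∈ Matrix.rowStochastic ℝ ι) (hc₀ : c₀ ∈ stdSimplex ℝ ι) {f : ι → ℝ} {θ : ℝ}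
    (h : Tendsto (fun n : ℕ => ∫ ω, |∑ i, urnProp R c₀ X n ω i * f i - θ| ∂μ) atTop (𝓝 0)) :
    Tendsto (fun n => ∫ ω, f (X n ω) ∂μ) atTop (𝓝 θ) := by
  rw [tendsto_iff_norm_sub_tendsto_zero]
  refine squeeze_zero (fun n => norm_nonneg _) (fun n => ?_) h
  rw [hX.integral_draw]
  have e : ∫ ω, ∑ i, urnProp R c₀ X n ω i * f i ∂μ - θ =
      ∫ ω, (∑ i, urnProp R c₀ X n ω i * f i - θ) ∂μ := by
    rw [integral_sub (integrable_sum_urnProp_mul hR hc₀ hX.measurableSet_draw f n)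
      (integrable_const θ)]
    simp
  rw [e]
  exact norm_integral_le_integral_norm _

end Urn

theorem tendsto_sum_urnProdIco_sq_div {β g₀ : ℝ} (hβ : β < 1 / 2) {g : ℕ → ℝ}
    (hg : Tendsto g atTop (𝓝 g₀)) :
    Tendsto (fun n : ℕ => (∑ k ∈ Finset.range n, urnProdIco β (k + 1) n ^ 2 * g k) / √(n : ℝ) ^ 2)
      atTop (𝓝 (1 / (1 - 2 * β) * g₀)) := by
  have h := tendsto_div_of_recursion hβ
    (S := fun n => ∑ k ∈ Finset.range n, urnProdIco β (k + 1) n ^ 2 * g k)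
    (sum_urnProdIco_sq_succ β g) hg
  rw [one_div_mul_eq_div]
  refine h.congr fun n => ?_
  rw [Real.sq_sqrt (by positivity)]

theorem tendsto_sum_urnProdIco_half_sq_div {g₀ : ℝ} {g : ℕ → ℝ} (hg : Tendsto g atTop (𝓝 g₀)) :
    Tendsto (fun n : ℕ => (∑ k ∈ Finset.range n, urnProdIco (1 / 2) (k + 1) n ^ 2 * g k) /
      √((n : ℝ) * Real.log n) ^ 2) atTop (𝓝 (1 * g₀)) := by
  have h := tendsto_div_mul_log_of_recursion
    (S := fun n => ∑ k ∈ Finset.range n, urnProdIco (1 / 2) (k + 1) n ^ 2 * g k) (by simp)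
    (sum_urnProdIco_sq_succ (1 / 2) g) hg
  rw [one_mul]
  refine h.congr fun n => ?_
  rw [Real.sq_sqrt (by positivity)]

theorem exists_abs_urnProdIco_div_sqrt_le {β : ℝ} (hβ1 : -1 ≤ β) (hβ : β < 1 / 2) :
    ∃ b : ℕ → ℝ, Tendsto b atTop (𝓝 0) ∧
      ∀ᶠ n : ℕ in atTop, ∀ k, |urnProdIco β k n / √(n : ℝ)| ≤ b n := by
  have hm : max β 0 < 1 / 2 := max_lt hβ (by norm_num)
  refine ⟨fun n => Real.exp (max β 0) * (n : ℝ) ^ (-(1 / 2 - max β 0)), ?_, ?_⟩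
  · have : Tendsto (fun n : ℕ => (n : ℝ) ^ (-(1 / 2 - max β 0))) atTop (𝓝 0) :=
      (tendsto_rpow_neg_atTop (by linarith)).comp tendsto_natCast_atTop_atTop
    simpa using this.const_mul (Real.exp (max β 0))
  · filter_upwards [eventually_ge_atTop 1] with n hn k
    have hn0 : (0 : ℝ) < n := by exact_mod_cast hn
    rw [abs_div, abs_of_nonneg (Real.sqrt_nonneg _), div_le_iff₀ (Real.sqrt_pos.2 hn0),
      Real.sqrt_eq_rpow, mul_assoc, ← Real.rpow_add hn0,
      show -(1 / 2 - max β 0) + 1 / 2 = max β 0 by ring]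
    exact abs_urnProdIco_le hβ1 k n hn

theorem exists_abs_urnProdIco_half_div_sqrt_le :
    ∃ b : ℕ → ℝ, Tendsto b atTop (𝓝 0) ∧
      ∀ᶠ n : ℕ in atTop, ∀ k, |urnProdIco (1 / 2) k n / √((n : ℝ) * Real.log n)| ≤ b n := by
  refine ⟨fun n => Real.exp (1 / 2) * (√(Real.log n))⁻¹, ?_, ?_⟩
  · have : Tendsto (fun n : ℕ => (√(Real.log n))⁻¹) atTop (𝓝 0) :=
      tendsto_inv_atTop_zero.comp (Real.tendsto_sqrt_atTop.comp
        (Real.tendsto_log_atTop.comp tendsto_natCast_atTop_atTop))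
    simpa using this.const_mul (Real.exp (1 / 2))
  · filter_upwards [eventually_ge_atTop 2] with n hn k
    have hn0 : (0 : ℝ) < n := by positivity
    have hl : 0 < Real.log n := Real.log_pos (by exact_mod_cast hn)
    have h := abs_urnProdIco_le (β := 1 / 2) (by norm_num) k n (by omega)
    rw [max_eq_left (by norm_num : (0 : ℝ) ≤ 1 / 2), ← Real.sqrt_eq_rpow] at h
    have hs := Real.sqrt_pos.2 hn0
    have hs2 := Real.sqrt_pos.2 hl
    rw [Real.sqrt_mul hn0.le, abs_div, abs_of_pos (mul_pos hs hs2),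
      div_le_iff₀ (mul_pos hs hs2)]
    refine h.trans (le_of_eq ?_)
    field_simp

/-! ### Linear algebra of the four-colour matrix -/

section FourColor

variable {s β : ℝ} {Q E P : Matrix (Fin 2) (Fin 2) ℝ}

theorem fourColorMatrix_mulVec_inr (v : Fin 2 ⊕ Fin 2 → ℝ)
    (hv : fourColorMatrix s Q E P *ᵥ v = β • v) :
    P *ᵥ (fun j => v (Sum.inr j)) = β • fun j => v (Sum.inr j) := by
  rw [fourColorMatrix, Matrix.fromBlocks_mulVec] at hv
  funext j
  have := congrFun hv (Sum.inr j)
  simpa [Function.comp_def] using this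

theorem fourColorMatrix_mulVec_elim_one_zero (hQ : Q ∈ Matrix.rowStochastic ℝ (Fin 2)) :
    fourColorMatrix s Q E P *ᵥ (Sum.elim 1 0 : Fin 2 ⊕ Fin 2 → ℝ) =
      s • (Sum.elim 1 0 : Fin 2 ⊕ Fin 2 → ℝ) := by
  rw [fourColorMatrix, Matrix.fromBlocks_mulVec]
  funext j
  rcases j with j | j <;> simp [Matrix.smul_mulVec, Matrix.one_vecMul_of_mem_rowStochastic hQ]

/-- An eigenvector for an eigenvalue of `P` does not vanish on the lower block. -/
theorem fourColorMatrix_eigenvector_inr_ne_zero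
    (hdist : (fourColorMatrix s Q E P).charpoly.roots.Nodup)
    (hβ : Module.End.HasEigenvalue (Matrix.toLin' P) β)
    {v : Fin 2 ⊕ Fin 2 → ℝ} (hv0 : v ≠ 0) (hv : fourColorMatrix s Q E P *ᵥ v = β • v) :
    (fun j => v (Sum.inr j)) ≠ 0 := by
  intro h0
  set u : Fin 2 → ℝ := fun j => v (Sum.inl j) with hu
  have hu0 : u ≠ 0 := by
    intro hu0
    apply hv0
    funext i
    rcases i with i | i
    · exact congrFun hu0 i
    · exact congrFun h0 i
  have hQu : (s • Q) *ᵥ u = β • u := by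
    rw [fourColorMatrix, Matrix.fromBlocks_mulVec] at hv
    funext j
    have := congrFun hv (Sum.inl j)
    simp only [Function.comp_def, h0, Sum.elim_inl] at this
    simpa using this
  have hQe : Module.End.HasEigenvalue (Matrix.toLin' (s • Q)) β :=
    Module.End.hasEigenvalue_of_hasEigenvector (x := u)
      ⟨Module.End.mem_eigenspace_iff.2 (by rw [Matrix.toLin'_apply, hQu]), hu0⟩
  rw [Module.End.hasEigenvalue_iff_isRoot_charpoly, Matrix.charpoly_toLin'] at hβ hQe
  -- The characteristic polynomial of the block matrix is the product of those of the blocks, so a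
  -- shared β would be a repeated root.
  rw [fourColorMatrix, Matrix.charpoly_fromBlocks_zero₂₁, Polynomial.roots_mul
    (mul_ne_zero (Matrix.charpoly_monic _).ne_zero (Matrix.charpoly_monic _).ne_zero),
    Multiset.nodup_add] at hdist
  exact Multiset.disjoint_left.1 hdist.2.2
    ((Polynomial.mem_roots (Matrix.charpoly_monic _).ne_zero).2 hQe)
    ((Polynomial.mem_roots (Matrix.charpoly_monic _).ne_zero).2 hβ)

/-- A vanishing off-diagonal entry makes the matrix triangular, and all its powers with it. -/
theorem Matrix.IsIrreducible.apply_pos_of_ne_fin_two (hP : P.IsIrreducible) {i j : Fin 2}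
    (hij : i ≠ j) : 0 < P i j := by
  refine lt_of_le_of_ne (hP.nonneg i j) fun h => ?_
  obtain ⟨k, -, hk⟩ := (Matrix.isIrreducible_iff_exists_pow_pos hP.nonneg).1 hP i j
  have hz : ∀ k, (P ^ k) i j = 0 := by
    intro k
    induction k with
    | zero => simp [hij]
    | succ k ih =>
      have huniv : (Finset.univ : Finset (Fin 2)) = {i, j} := by
        fin_cases i <;> fin_cases j <;> first | decide | exact absurd rfl hij
      rw [pow_succ', Matrix.mul_apply, huniv, Finset.sum_pair hij, ih, ← h]
      simp
  exact hk.ne' (hz k)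

/-- Subtract the two eigenvector equations; ν 0 = ν 1 would force the eigenvalue 1. The formula
yields -1 ≤ β ≤ 1. -/
theorem eigenvalue_eq_of_fin_two (hP : P ∈ Matrix.rowStochastic ℝ (Fin 2)) {ν : Fin 2 → ℝ}
    (hν0 : ν ≠ 0) (hν : P *ᵥ ν = β • ν) (hβ1 : β ≠ 1) : β = P 0 0 - P 1 0 := by
  have r0 := Matrix.sum_row_of_mem_rowStochastic hP 0
  have r1 := Matrix.sum_row_of_mem_rowStochastic hP 1
  have e0 := congrFun hν 0
  have e1 := congrFun hν 1
  simp only [Matrix.mulVec, dotProduct, Fin.sum_univ_two, Pi.smul_apply, smul_eq_mul]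
    at r0 r1 e0 e1
  have hne : ν 0 - ν 1 ≠ 0 := by
    intro h
    have h1 : ν 1 = ν 0 := by linarith
    have h0 : (1 - β) * ν 0 = 0 := by
      rw [h1] at e0
      linear_combination e0 - ν 0 * r0
    have h2 : ν 0 = 0 := (mul_eq_zero.1 h0).resolve_left (sub_ne_zero.2 hβ1.symm)
    apply hν0
    funext j
    fin_cases j
    · exact h2
    · exact h1.trans h2
  refine mul_right_cancel₀ hne ?_
  linear_combination e1 - e0 + ν 1 * (r0 - r1)

theorem stationary_dotProduct_eq_zero {p ν : Fin 2 → ℝ} (hpP : p ᵥ* P = p)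
    (hν : P *ᵥ ν = β • ν) (hβ1 : β ≠ 1) : p ⬝ᵥ ν = 0 := by
  have h : p ⬝ᵥ ν = β * (p ⬝ᵥ ν) := by
    calc p ⬝ᵥ ν = (p ᵥ* P) ⬝ᵥ ν := by rw [hpP]
      _ = p ⬝ᵥ (P *ᵥ ν) := (Matrix.dotProduct_mulVec _ _ _).symm
      _ = _ := by rw [hν, dotProduct_smul, smul_eq_mul]
  have h2 : (1 - β) * (p ⬝ᵥ ν) = 0 := by linear_combination h
  exact (mul_eq_zero.1 h2).resolve_left (sub_ne_zero.2 hβ1.symm)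

/-- Both coordinates are roots of (x - ν_0)(x - ν_1), so ν_j² = (ν_0 + ν_1) ν_j - ν_0 ν_1; averaging
against p gives p ν² = -ν_0 ν_1. -/
theorem sq_sub_dotProduct_sq_eq {p ν : Fin 2 → ℝ} (hp : p ∈ stdSimplex ℝ (Fin 2))
    (h : p ⬝ᵥ ν = 0) (j : Fin 2) : ν j ^ 2 - p ⬝ᵥ ν ^ 2 = (ν 0 + ν 1) * ν j := by
  have h1 := hp.2
  simp only [dotProduct, Fin.sum_univ_two, Pi.pow_apply] at h h1 ⊢
  fin_cases j
  · simp only [Fin.zero_eta]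
    linear_combination (-ν 0 - ν 1) * h + (ν 0 * ν 1) * h1
  · simp only [Fin.mk_one]
    linear_combination (-ν 0 - ν 1) * h + (ν 0 * ν 1) * h1

/-- Stationarity is the balance p_0 P_01 = p_1 P_10; as both off-diagonal entries are positive, p
charges both states. -/
theorem stationary_dotProduct_sq_pos (hPirr : P.IsIrreducible)
    {p ν : Fin 2 → ℝ} (hp : p ∈ stdSimplex ℝ (Fin 2)) (hpP : p ᵥ* P = p) (hν0 : ν ≠ 0)
    (hP : P ∈ Matrix.rowStochastic ℝ (Fin 2)) : 0 < p ⬝ᵥ ν ^ 2 := by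
  have a := hPirr.apply_pos_of_ne_fin_two (i := 0) (j := 1) (by decide)
  have b := hPirr.apply_pos_of_ne_fin_two (i := 1) (j := 0) (by decide)
  have r0 := Matrix.sum_row_of_mem_rowStochastic hP 0
  have e := congrFun hpP 0
  have h1 := hp.2
  have p0 := hp.1 0
  have p1 := hp.1 1
  simp only [Matrix.vecMul, dotProduct, Fin.sum_univ_two] at r0 e h1
  have hbal : p 0 * P 0 1 = p 1 * P 1 0 := by linear_combination p 0 * r0 - e
  have hp0 : 0 < p 0 := by
    refine lt_of_le_of_ne p0 fun h => ?_
    rw [← h] at hbal h1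
    have : p 1 = 1 := by linarith
    rw [this] at hbal
    linarith
  have hp1 : 0 < p 1 := by
    refine lt_of_le_of_ne p1 fun h => ?_
    rw [← h] at hbal h1
    have : p 0 = 1 := by linarith
    rw [this] at hbal
    linarith
  obtain ⟨j, hj⟩ := Function.ne_iff.1 hν0
  refine Finset.sum_pos' (fun i _ => mul_nonneg (hp.1 i) (sq_nonneg _)) ⟨j, Finset.mem_univ j, ?_⟩
  have : 0 < p j := by fin_cases j <;> assumption
  have hj2 : 0 < ν j ^ 2 := by
    have : ν j ≠ 0 := hj
    positivity
  exact mul_pos this hj2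

end FourColor

/-! ### The three regimes -/

theorem proposition4p3
    {Ω : Type*} [MeasurableSpace Ω] (μ : Measure Ω) [IsProbabilityMeasure μ]
    (s : ℝ) (hs0 : 0 < s) (hs1 : s < 1)
    (Q E P : Matrix (Fin 2) (Fin 2) ℝ)
    (hQ : Q ∈ Matrix.rowStochastic ℝ (Fin 2)) (hQirr : Q.IsIrreducible)
    (hP : P ∈ Matrix.rowStochastic ℝ (Fin 2)) (hPirr : P.IsIrreducible)
    (hR : fourColorMatrix s Q E P ∈ Matrix.rowStochastic ℝ (Fin 2 ⊕ Fin 2))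
    -- all eigenvalues of the replacement matrix are distinct
    (hdist : (fourColorMatrix s Q E P).charpoly.roots.Nodup)
    -- `β` is the eigenvalue of `P` other than `1`
    (β : ℝ) (hβ : Module.End.HasEigenvalue (Matrix.toLin' P) β) (hβ1 : β ≠ 1)
    -- `v` is a right eigenvector of the replacement matrix for `β`
    (v : Fin 2 ⊕ Fin 2 → ℝ) (hv0 : v ≠ 0) (hv : fourColorMatrix s Q E P *ᵥ v = β • v)
    -- `ν` is the lower half of `v`
    (ν : Fin 2 → ℝ) (hν : ν = fun j => v (Sum.inr j))
    -- `p` is the stationary distribution of `P`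
    (p : Fin 2 → ℝ) (hp : p ∈ stdSimplex ℝ (Fin 2)) (hpP : p ᵥ* P = p)
    -- the urn process
    (c₀ : Fin 2 ⊕ Fin 2 → ℝ) (hc₀ : c₀ ∈ stdSimplex ℝ (Fin 2 ⊕ Fin 2))
    (X : ℕ → Ω → Fin 2 ⊕ Fin 2)
    (hX : IsUrnDraws μ (fourColorMatrix s Q E P) c₀ X)
    (C : ℕ → Ω → Fin 2 ⊕ Fin 2 → ℝ) (hC : C = urnContents (fourColorMatrix s Q E P) c₀ X) :
    (β < 1 / 2 →
      TendstoInDistribution (fun (n : ℕ) ω => (C n ω ⬝ᵥ v) / √(n : ℝ)) atTop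
        (fun x : ℝ => x) (fun _ => μ)
        (gaussianReal 0 (Real.toNNReal (β ^ 2 / (1 - 2 * β) * (p ⬝ᵥ ν ^ 2))))) ∧
    (β = 1 / 2 →
      TendstoInDistribution (fun (n : ℕ) ω => (C n ω ⬝ᵥ v) / √((n : ℝ) * Real.log n)) atTop
        (fun x : ℝ => x) (fun _ => μ)
        (gaussianReal 0 (Real.toNNReal (β ^ 2 * (p ⬝ᵥ ν ^ 2))))) ∧
    (1 / 2 < β →
      (Martingale (fun (n : ℕ) ω => (C n ω ⬝ᵥ v) / urnProd n β)
          (urnFiltration (fourColorMatrix s Q E P) c₀ X hX.measurableSet_draw) μ ∧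
        ∃ K : ℝ≥0, ∀ n : ℕ, eLpNorm (fun ω => (C n ω ⬝ᵥ v) / urnProd n β) 2 μ ≤ K) ∧
      ∃ Z : Ω → ℝ, Measurable Z ∧
        (∀ᵐ ω ∂μ, Tendsto (fun n : ℕ => (C n ω ⬝ᵥ v) / (n : ℝ) ^ β) atTop (𝓝 (Z ω))) ∧
        ¬ ∃ c : ℝ, Z =ᵐ[μ] fun _ => c) := by
  subst hC
  set R := fourColorMatrix s Q E P with hRdef
  have hPν : P *ᵥ ν = β • ν := hν ▸ fourColorMatrix_mulVec_inr v hv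
  have hν0 : ν ≠ 0 := hν ▸ fourColorMatrix_eigenvector_inr_ne_zero hdist hβ hv0 hv
  have hβeq := eigenvalue_eq_of_fin_two hP hν0 hPν hβ1
  have hβ_le : β ≤ 1 := by
    have h0 := Matrix.le_one_of_mem_rowStochastic hP (i := 0) (j := 0)
    have h1 := Matrix.nonneg_of_mem_rowStochastic hP (i := 1) (j := 0)
    linarith
  have hβ_ge : -1 ≤ β := by
    have h0 := Matrix.nonneg_of_mem_rowStochastic hP (i := 0) (j := 0)
    have h1 := Matrix.le_one_of_mem_rowStochastic hP (i := 1) (j := 0)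
    linarith
  have hβ_lt : β < 1 := lt_of_le_of_ne hβ_le hβ1
  have hpν := stationary_dotProduct_eq_zero hpP hPν hβ1
  have hτ : 0 < p ⬝ᵥ ν ^ 2 := stationary_dotProduct_sq_pos hPirr hp hpP hν0 hP
  set τ := p ⬝ᵥ ν ^ 2 with hτdef
  have hw := fourColorMatrix_mulVec_elim_one_zero (s := s) (E := E) (P := P) hQ
  have hw0 : ∀ i, (0 : ℝ) ≤ (Sum.elim 1 0 : Fin 2 ⊕ Fin 2 → ℝ) i := by
    rintro (i | i) <;> simp
  have hinr : ∀ j, v (Sum.inr j) ^ 2 - τ - (ν 0 + ν 1) * v (Sum.inr j) = 0 := fun j => by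
    have h := sq_sub_dotProduct_sq_eq hp hpν j
    have hj : ν j = v (Sum.inr j) := by rw [hν]
    rw [← hj, h, sub_self]
  -- On green and yellow the relation `hinr` is exact; on white and black any finite error D is
  -- allowed, as their share vanishes. The scale a is β² for the local error and 1 for the
  -- nondegeneracy of the limit.
  have hlln : ∀ a : ℝ, Tendsto (fun n : ℕ =>
      ∫ ω, |∑ i, urnProp R c₀ X n ω i * (a * v i ^ 2) - a * τ| ∂μ) atTop (𝓝 0) := fun a => by
    refine hX.tendsto_integral_abs_sum_urnProp_sub (κ := a * (ν 0 + ν 1))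
      (D := ∑ j, |a * v (Sum.inl j) ^ 2 - a * τ - a * (ν 0 + ν 1) * v (Sum.inl j)|)
      hR hc₀ hw hw0 hs1 hv hβ_ge hβ_lt ?_
    rintro (j | j)
    · simpa using Finset.single_le_sum (f := fun j =>
        |a * v (Sum.inl j) ^ 2 - a * τ - a * (ν 0 + ν 1) * v (Sum.inl j)|)
        (fun _ _ => abs_nonneg _) (Finset.mem_univ j)
    · have : a * v (Sum.inr j) ^ 2 - a * τ - a * (ν 0 + ν 1) * v (Sum.inr j) = 0 := by
        linear_combination a * hinr j
      rw [this]
      simp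
  set θ := β ^ 2 * τ with hθdef
  have hθ : 0 ≤ θ := by positivity
  have herr : Tendsto (urnError μ R c₀ X (fun i => β * v i) θ) atTop (𝓝 0) := by
    refine hX.tendsto_urnError hR hc₀ hv hβ_ge hβ_lt ?_
    simpa only [mul_pow] using hlln (β ^ 2)
  -- A single constant bounding both the increments and the standard deviation √θ.
  set K := ‖fun i => β * v i‖ + √θ with hKdef
  have hK : ∀ i, |β * v i| ≤ K := fun i =>
    (norm_le_pi_norm (fun i => β * v i) i).trans (le_add_of_nonneg_right (Real.sqrt_nonneg _))
  have hθK : θ ≤ K ^ 2 := by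
    rw [← Real.sqrt_le_left (by positivity)]
    exact le_add_of_nonneg_left (norm_nonneg _)
  refine ⟨fun hlt => ?_, fun heq => ?_, fun hgt => ⟨⟨?_, ?_⟩, ?_⟩⟩
  · obtain ⟨b, hb, hrb⟩ := exists_abs_urnProdIco_div_sqrt_le hβ_ge hlt
    have hc : 0 ≤ 1 / (1 - 2 * β) := one_div_nonneg.2 (by linarith)
    have h := hX.tendstoInDistribution hR hc₀ hv hK hθ hθK herr hb hrb
      (fun g g₀ hg => tendsto_sum_urnProdIco_sq_div hlt hg) hc
    rwa [hθdef, ← mul_assoc, one_div_mul_eq_div] at h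
  · obtain ⟨b, hb, hrb⟩ := exists_abs_urnProdIco_half_div_sqrt_le
    rw [← heq] at hrb
    have h := hX.tendstoInDistribution hR hc₀ hv hK hθ hθK herr hb hrb
      (fun g g₀ hg => by rw [heq]; exact tendsto_sum_urnProdIco_half_sq_div hg) zero_le_one
    rwa [one_mul] at h
  · exact hX.martingale hR hc₀ hv (by linarith)
  · exact hX.exists_eLpNorm_two_le hR hc₀ hv hgt
  · refine hX.exists_ae_tendsto hR hc₀ hv hgt hβ_lt hτ ?_
    refine hX.tendsto_integral_draw hR hc₀ (f := fun i => v i ^ 2) ?_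
    simpa only [one_mul] using hlln 1
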